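/- **Setting.** Let $n\ge 1$, $d\ge 0$. Let $L:[0,\infty)\to\mathbb R^{n\times n}$ be measurable and locally essentially bounded, such that every $L(t)$ is a generalized Laplacian: its off-diagonal entries are nonpositive and its columns sum to zero, $\mathbf 1^TL(t)=0$. ($L(t)$ need not be weight-balanced: its rows need not sum to zero.) Solutions of differential equations are Carathéodory solutions: absolutely continuous on compact intervals and satisfying the equation almost everywhere. For $t\ge s\ge 0$ let $\Phi(t,s)$ be the transition matrix given by $\frac{d}{dt}\Phi(t,s)=-L(t)\Phi(t,s)$, $\Phi(s,s)=I$. Let $\mathbb S_1$ be the set of rank-one column-stochastic matrices (column-stochastic matrices with all columns equal), and let $d(\cdot,\mathbb S_1)$ be the distance to $\mathbb S_1$ in some matrix norm. The flow $\{\Phi(t,s)\}$ is *in class $P^*$* if there is $p^*>0$ with $\Phi(t,s)\mathbf 1\ge p^*\mathbf 1$ entrywise for all $t\ge s\ge0$. It is *weakly exponentially ergodic* if there are $a>0$ and $\lambda\in(0,1)$ with $d(\Phi(t,s),\mathbb S_1)\le a\lambda^{t-s}$ for all $t\ge s\ge 0$. **Push-sum dynamics.** For a locally integrable input $\mathbf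 u=(u_1,\dots,u_n):[0,\infty)\to\mathbb R^{n\times d}$, the state $(\mathbf x,w)\in\mathbb R^{n\times d}\times\mathbb R^n$ and the output $\mathbf y\in\mathbb R^{n\times d}$ (row $i$ of $\mathbf x$, $\mathbf y$, $\mathbf u$ being $x_i,y_i,u_i\in\mathbb R^d$) satisfy $$\dot{\mathbf x}(t)=-L(t)\mathbf x(t)+\mathbf u(t),\qquad \dot w(t)=-L(t)w(t),\qquad y_i(t)=\frac{x_i(t)}{w_i(t)} .$$ Write $\bar{\mathbf x}=\frac1n\sum_i x_i$ and $\bar{\mathbf u}=\frac1n\sum_iu_i$. Such a system is a *flow tracker with respect to* a set $Q$ of initial states if there are $c>0$ and $\lambda\in(0,1)$ such that, for every locally integrable input $\mathbf u$ and every corresponding trajectory with $(\mathbf x(0),w(0))\in Q$: (i) $\dot{\bar{\mathbf x}}(t)=\bar{\mathbf u}(t)$; and (ii) for all $t\ge0$ and all $i$, $$\|y_i(t)-\bar{\mathbf x}(t)\|\le c\Big(\lambda^t\|\mathbf x(0)\|+\int_0^t\lambda^{t-\tau}\|\mathbf u(\tau)\|\,d\tau\Big).$$ **Optimization problem.** Minimize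 $F=\sum_{i=1}^nf_i$ over $\mathbb R^d$, where each $f_i:\mathbb R^d\to\mathbb R$ is convex, the set $X^*$ of minimizers of $F$ is non-empty, and there is a constant $K$ with $\|g\|\le K(1+\|x\|)$ for all $i$, all $x$ and all $g\in\partial f_i(x)$ (this holds in particular if the (sub)gradients are bounded or the gradients are Lipschitz). The step size $\alpha:[0,\infty)\to[0,\infty)$ is measurable with $\int_0^\infty\alpha(t)\,dt=\infty$ and $\int_0^\infty\alpha(t)^2dt<\infty$. **Theorem.** Suppose that $\{\Phi(t,s)\}$ is a class $P^*$ weakly exponentially ergodic flow. Then, along every trajectory of the push-sum dynamics with $w(0)=\mathbf 1$, $w_i(t)>0$ for all $i$ and all $t\ge0$, so that $y_i$ is well defined, and the push-sum dynamics is a flow tracker with respect to $Q=\mathbb R^{n\times d}\times\{\mathbf 1\}$. Moreover, for every optimization problem and step size as above, consider any trajectory of the push-sum dynamics with $w(0)=\mathbf 1$ and arbitrary $\mathbf x(0)$, under the feedback $\mathbf u(t)=-\alpha(t)\nabla\tilde F(\mathbf y(t))$, i.e. for almost every $t\ge 0$ and every $i$, $u_i(t)=-\alpha(t)g_i(t)$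 with $g_i(t)\in\partial f_i(y_i(t))$ (so $u_i(t)=-\alpha(t)\nabla f_i(y_i(t))$ if $f_i$ is differentiable). Then there is $x^*\in X^*$ with $\lim_{t\to\infty}y_i(t)=x^*$ for all $i$. -/

import Mathlib

open MeasureTheory Filter Topology Set
open scoped Gradient

/- Matrices carry the entrywise sup norm.  All norms on a finite-dimensional space are equivalent, so
the choice only affects multiplicative constants, which are existentially quantified below. -/
attribute [local instance] Matrix.normedAddCommGroup Matrix.normedSpace

namespace PushSum

/-! ### Carathéodory solutions -/

/-- `x` is a Carathéodory solution of `ẋ = g(t, x)` on `[s, ∞)`: it is absolutely continuous on every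
`[s, T]` and satisfies the equation at almost every time. -/
def IsCaratheodorySolution {E : Type*} [NormedAddCommGroup E] [NormedSpace ℝ E]
    (g : ℝ → E → E) (s : ℝ) (x : ℝ → E) : Prop :=
  (∀ T, s ≤ T → AbsolutelyContinuousOnInterval x s T) ∧
    ∀ᵐ t : ℝ, s < t → HasDerivAt x (g t (x t)) t

/-! ### Laplacian flows -/

/-- Generalized Laplacian: nonpositive off-diagonal entries and zero column sums (the convention
under which the flow of `ẋ = -L x` is column-stochastic).  Zero row sums are not required. -/
def IsGeneralizedLaplacian {n : ℕ} (A : Matrix (Fin n) (Fin n) ℝ) : Prop :=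
  (∀ i j, i ≠ j → A i j ≤ 0) ∧ ∀ j, ∑ i, A i j = 0

/-- `L` is measurable and locally essentially bounded on `[0, ∞)`, with generalized Laplacian
values. -/
structure IsLaplacianProcess {n : ℕ} (L : ℝ → Matrix (Fin n) (Fin n) ℝ) : Prop where
  measurable : ∀ i j, AEMeasurable (fun t => L t i j) (volume.restrict (Ici 0))
  locally_ess_bounded : ∀ T : ℝ, ∃ C : ℝ, ∀ᵐ t : ℝ, t ∈ Icc 0 T → ∀ i j, |L t i j| ≤ C
  laplacian : ∀ t, 0 ≤ t → IsGeneralizedLaplacian (L t)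

/-- `Φ(t, s)`, `t ≥ s ≥ 0`, is the transition matrix of `ẋ = -L(t) x`. -/
def IsFlow {n : ℕ} (L : ℝ → Matrix (Fin n) (Fin n) ℝ)
    (Φ : ℝ → ℝ → Matrix (Fin n) (Fin n) ℝ) : Prop :=
  ∀ s, 0 ≤ s → Φ s s = 1 ∧
    IsCaratheodorySolution (fun t A => -(L t * A)) s (fun t => Φ t s)

/-- Rank-one column-stochastic matrices, i.e. the column-stochastic matrices `π 1ᵀ` whose columns are
all the same vector `π`. -/
def rankOneStochastic (n : ℕ) : Set (Matrix (Fin n) (Fin n) ℝ) :=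
  {A | A ∈ Matrix.colStochastic ℝ (Fin n) ∧ ∃ π : Fin n → ℝ, A = Matrix.vecMulVec π 1}

/-- Class `P*`: `Φ(t, s) 1 ≥ p* 1` entrywise for some `p* > 0`. -/
def IsClassPStar {n : ℕ} (Φ : ℝ → ℝ → Matrix (Fin n) (Fin n) ℝ) : Prop :=
  ∃ p : ℝ, 0 < p ∧ ∀ s t, 0 ≤ s → s ≤ t → ∀ i, p ≤ (Φ t s).mulVec 1 i

/-- Weak exponential ergodicity: the distance of `Φ(t, s)` to the rank-one stochastic matrices is at
most `a λ^(t-s)`. -/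
def IsWeaklyExponentiallyErgodic {n : ℕ} (Φ : ℝ → ℝ → Matrix (Fin n) (Fin n) ℝ) : Prop :=
  ∃ a lam : ℝ, 0 < a ∧ 0 < lam ∧ lam < 1 ∧ ∀ s t, 0 ≤ s → s ≤ t →
    Metric.infDist (Φ t s) (rankOneStochastic n) ≤ a * lam ^ (t - s)

/-! ### Input-output dynamics and flow trackers -/

/-- `ℝ^{n×d}`: one Euclidean vector for each agent (normed by the largest Euclidean row norm). -/
abbrev AgentVec (n d : ℕ) : Type := Fin n → EuclideanSpace ℝ (Fin d)

/-- The average of the agents' vectors. -/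
noncomputable def average {n d : ℕ} (x : AgentVec n d) : EuclideanSpace ℝ (Fin d) :=
  (n : ℝ)⁻¹ • ∑ i, x i

/-- Input-output dynamics `ẋ = dx(t, x, w, u)`, `ẇ = dw(t, x, w, u)`, `y = out(t, x, w)` with state
`(x, w) ∈ ℝ^{n×d} × ℝ^N`, input `u` and output `y` in `ℝ^{n×d}`. -/
structure InputOutputDynamics (n d N : ℕ) where
  dx : ℝ → AgentVec n d → (Fin N → ℝ) → AgentVec n d → AgentVec n d
  dw : ℝ → AgentVec n d → (Fin N → ℝ) → AgentVec n d → (Fin N → ℝ)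
  out : ℝ → AgentVec n d → (Fin N → ℝ) → AgentVec n d

/-- `(x, w)` is a trajectory on `[0, ∞)` driven by the locally integrable input `u`. -/
def InputOutputDynamics.IsTrajectory {n d N : ℕ} (S : InputOutputDynamics n d N)
    (u x : ℝ → AgentVec n d) (w : ℝ → Fin N → ℝ) : Prop :=
  LocallyIntegrableOn u (Ici 0) ∧
    IsCaratheodorySolution (fun t (p : AgentVec n d × (Fin N → ℝ)) =>
      (S.dx t p.1 p.2 (u t), S.dw t p.1 p.2 (u t))) 0 (fun t => (x t, w t))

/-- Flow tracker with respect to the set `Q` of initial states: along every trajectory starting in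
`Q`, the average state obeys `d/dt x̄ = ū`, and every output `y_i` observes `x̄` at an exponential rate,
with constants independent of the trajectory and of the input. -/
def InputOutputDynamics.IsFlowTracker {n d N : ℕ} (S : InputOutputDynamics n d N)
    (Q : Set (AgentVec n d × (Fin N → ℝ))) : Prop :=
  ∃ c lam : ℝ, 0 < c ∧ 0 < lam ∧ lam < 1 ∧
    ∀ (u x : ℝ → AgentVec n d) (w : ℝ → Fin N → ℝ), S.IsTrajectory u x w → (x 0, w 0) ∈ Q →
      IsCaratheodorySolution (fun t _ => average (u t)) 0 (fun t => average (x t)) ∧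
      ∀ t, 0 ≤ t → ∀ i, ‖S.out t (x t) (w t) i - average (x t)‖ ≤
        c * (lam ^ t * ‖x 0‖ + ∫ τ in (0 : ℝ)..t, lam ^ (t - τ) * ‖u τ‖)

/-- Push-sum: `ẋ = -L(t) x + u`, `ẇ = -L(t) w`, `y_i = x_i / w_i`. -/
noncomputable def pushSum {n : ℕ} (d : ℕ) (L : ℝ → Matrix (Fin n) (Fin n) ℝ) :
    InputOutputDynamics n d n where
  dx t x _ u := fun i => -(∑ j, L t i j • x j) + u i
  dw t _ w _ := -((L t).mulVec w)
  out _ x w := fun i => (w i)⁻¹ • x i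

/-- `Q = ℝ^{n×d} × {1}`. -/
def pushSumInit (n d : ℕ) : Set (AgentVec n d × (Fin n → ℝ)) :=
  Set.univ ×ˢ {1}

/-! ### The distributed optimization problem -/

/-- The subdifferential of a convex function. -/
def subdifferential {d : ℕ} (f : EuclideanSpace ℝ (Fin d) → ℝ) (x : EuclideanSpace ℝ (Fin d)) :
    Set (EuclideanSpace ℝ (Fin d)) :=
  {g | ∀ z, f x + inner ℝ g (z - x) ≤ f z}

/-- Where a convex function is differentiable, its only subgradient is the gradient; so for
differentiable local objectives the feedback below is `u_i = -α(t) ∇f_i(y_i)`. -/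
theorem subdifferential_eq_gradient {d : ℕ} {f : EuclideanSpace ℝ (Fin d) → ℝ}
    (hf : ConvexOn ℝ Set.univ f) {x : EuclideanSpace ℝ (Fin d)} (hx : DifferentiableAt ℝ f x) :
    subdifferential f x = {∇ f x} := by
  have hgr : HasFDerivAt f (InnerProductSpace.toDual ℝ _ (∇ f x)) x :=
    hx.hasGradientAt.hasFDerivAt
  ext g
  simp only [subdifferential, Set.mem_ofPred_eq, Set.mem_singleton_iff]
  constructor
  · intro hg
    have hmin : IsLocalMin (fun z => f z - inner ℝ g z) x := by
      refine Filter.Eventually.of_forall fun z => ?_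
      have := hg z
      rw [inner_sub_right] at this
      simp only
      linarith
    have hd : HasFDerivAt (fun z => f z - inner ℝ g z)
        (InnerProductSpace.toDual ℝ _ (∇ f x) - InnerProductSpace.toDual ℝ _ g) x :=
      hgr.sub (InnerProductSpace.toDual ℝ _ g).hasFDerivAt
    have h0 := hmin.hasFDerivAt_eq_zero hd
    exact ((InnerProductSpace.toDual ℝ _).injective (sub_eq_zero.mp h0)).symm
  · rintro rfl z
    have hline : HasDerivAt (fun s : ℝ => x + s • (z - x)) (z - x) 0 := by
      simpa using ((hasDerivAt_id (0 : ℝ)).smul_const (z - x)).const_add x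
    have hcomp : HasDerivAt (fun s : ℝ => f (x + s • (z - x))) (inner ℝ (∇ f x) (z - x)) 0 := by
      have h' : HasFDerivAt f (InnerProductSpace.toDual ℝ _ (∇ f x)) (x + (0 : ℝ) • (z - x)) := by
        simpa using hgr
      exact h'.comp_hasDerivAt (0 : ℝ) hline
    have hlim := (hasDerivWithinAt_iff_tendsto_slope' (by simp)).mp
      (hcomp.hasDerivWithinAt (s := Set.Ioi 0))
    have hle : inner ℝ (∇ f x) (z - x) ≤ f z - f x := by
      refine le_of_tendsto hlim ?_
      filter_upwards [Ioo_mem_nhdsGT (zero_lt_one' ℝ)] with s hs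
      have hc := hf.2 (Set.mem_univ x) (Set.mem_univ z) (sub_nonneg.mpr hs.2.le) hs.1.le
        (sub_add_cancel 1 s)
      have he : (1 - s) • x + s • z = x + s • (z - x) := by
        rw [sub_smul, one_smul, smul_sub]; abel
      rw [he] at hc
      simp only [smul_eq_mul] at hc
      simp only [slope_def_field, sub_zero, zero_smul, add_zero]
      rw [div_le_iff₀ hs.1]
      linarith
    linarith

/-- The global minimizers of `F = ∑ i, f_i`. -/
def optimalSet {n d : ℕ} (f : Fin n → EuclideanSpace ℝ (Fin d) → ℝ) :
    Set (EuclideanSpace ℝ (Fin d)) :=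
  {x | ∀ z, ∑ i, f i x ≤ ∑ i, f i z}

/-- Standing assumption on the optimization problem: convex local objectives whose subgradients grow
at most linearly (in particular, bounded subgradients or Lipschitz gradients), and at least one
optimal point. -/
structure OptimizationAssumption {n d : ℕ} (f : Fin n → EuclideanSpace ℝ (Fin d) → ℝ) : Prop where
  convex : ∀ i, ConvexOn ℝ Set.univ (f i)
  growth : ∃ K : ℝ, ∀ i x, ∀ g ∈ subdifferential (f i) x, ‖g‖ ≤ K * (1 + ‖x‖)
  nonempty : (optimalSet f).Nonempty

/-- Standing assumption on the step size: `α ≥ 0` is measurable on `[0, ∞)`, with `∫ α² < ∞` and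
`∫ α = ∞`. -/
structure StepSizeAssumption (α : ℝ → ℝ) : Prop where
  measurable : AEMeasurable α (volume.restrict (Ici 0))
  nonneg : ∀ t, 0 ≤ t → 0 ≤ α t
  sq_integrable : IntegrableOn (fun t => α t ^ 2) (Ici 0)
  integral_eq_top : ∫⁻ t in Ici (0 : ℝ), ENNReal.ofReal (α t) = ⊤

/-- The feedback `u(t) = -α(t) ∇F̃(y(t))` at almost every time: `u_i(t) = -α(t) g_i(t)` with `g_i(t)` a
subgradient of `f_i` at `y_i(t)`. -/
def IsGradientFeedback {n d : ℕ} (f : Fin n → EuclideanSpace ℝ (Fin d) → ℝ) (α : ℝ → ℝ)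
    (u y : ℝ → AgentVec n d) : Prop :=
  ∀ᵐ t : ℝ, 0 ≤ t → ∀ i, ∃ g ∈ subdifferential (f i) (y t i), u t i = -(α t • g)

end PushSum

namespace PushSum

/-! ### Absolutely continuous functions -/

/-! Tracking. Zero column sums make `Φ(t,s)` preserve total mass, and ergodicity says `Φ(t,s)` is
within `O(λ^(t-s))` of some `π 1ᵀ`. Since the total of `w(s)` is `n`, applying `Φ(t,s)` to `w(s)`
gives `w(t) ≈ n π`, so `π` may be replaced by `w(t)/n` (`IsFlow.exists_abs_sub_weight_le`). Inserted
into variation of constants, this yields `x(t) ≈ w(t) x̄(t)` with an exponentially discounted error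
(`IsFlow.exists_tracking_bound`). Class `P*` keeps `w_i` above a positive constant, so division by
it preserves the estimate (`pushSum_isFlowTracker`).

Optimization. Only the tracking property matters from here on. Its right-hand side `E` solves `E' =
-μ E + c ‖u‖` with `μ = -log λ`, while `z = x̄` follows `z' = ū`, a subgradient flow for `F`
perturbed by `y_i - z`, whose norm is at most `E`. For a minimizer `x*` put `N = ‖z - x*‖` and `Δ =
F(z) - F(x*)`. The function `U = 1 + N² + 2E²` satisfies `U' ≤ -κ α Δ + M α² U`. As `α²` is
integrable, `U` converges; a second comparison gives `E → 0`, hence `N` converges; as `α` is not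
integrable, `Δ` is arbitrarily small at arbitrarily late times (`lyapunov_convergence`). Some
cluster point of `z` is therefore optimal, and the distance to it converges, necessarily to `0`
(`averaged_dynamics_converges`).

Solutions are only Carathéodory, so every comparison argument goes through the fundamental theorem
of calculus for absolutely continuous functions (`le_of_ae_deriv_nonpos`). -/

theorem absolutelyContinuous_comp_lipschitzOn {X Y : Type*} [PseudoMetricSpace X]
    [PseudoMetricSpace Y] {f : ℝ → X} {a b : ℝ} {φ : X → Y} {K : NNReal}
    (hf : AbsolutelyContinuousOnInterval f a b) (hφ : LipschitzOnWith K φ (f '' uIcc a b)) :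
    AbsolutelyContinuousOnInterval (fun t => φ (f t)) a b := by
  have h0 : Tendsto (fun E : ℕ × (ℕ → ℝ × ℝ) =>
      (K : ℝ) * ∑ i ∈ Finset.range E.1, dist (f (E.2 i).1) (f (E.2 i).2))
      (AbsolutelyContinuousOnInterval.totalLengthFilter ⊓
        𝓟 (AbsolutelyContinuousOnInterval.disjWithin a b)) (𝓝 0) := by
    have := Tendsto.const_mul (K : ℝ) hf
    rwa [mul_zero] at this
  refine squeeze_zero' (Eventually.of_forall fun _ => Finset.sum_nonneg fun _ _ => dist_nonneg)
    ?_ h0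
  rw [eventually_inf_principal]
  filter_upwards with E hE
  rw [Finset.mul_sum]
  refine Finset.sum_le_sum fun i hi => ?_
  exact hφ.dist_le_mul _ (mem_image_of_mem _ (hE.1 i hi).1) _ (mem_image_of_mem _ (hE.1 i hi).2)

/-- The curve has compact image, on which a locally Lipschitz map is Lipschitz. -/
theorem absolutelyContinuous_comp_locallyLipschitz {X Y : Type*} [SeminormedAddCommGroup X]
    [PseudoMetricSpace Y] {f : ℝ → X} {a b : ℝ} {φ : X → Y}
    (hf : AbsolutelyContinuousOnInterval f a b) (hφ : LocallyLipschitz φ) :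
    AbsolutelyContinuousOnInterval (fun t => φ (f t)) a b := by
  have hc : IsCompact (f '' uIcc a b) := isCompact_uIcc.image_of_continuousOn hf.continuousOn
  have hl : LocallyLipschitzOn (f '' uIcc a b) φ := hφ.locallyLipschitzOn
  obtain ⟨K, hK⟩ := LocallyLipschitzOn.exists_lipschitzOnWith_of_compact hc hl
  exact absolutelyContinuous_comp_lipschitzOn hf hK

theorem absolutelyContinuous_clm {E F : Type*} [NormedAddCommGroup E] [NormedSpace ℝ E]
    [NormedAddCommGroup F] [NormedSpace ℝ F] {f : ℝ → E} {a b : ℝ}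
    (hf : AbsolutelyContinuousOnInterval f a b) (φ : E →L[ℝ] F) :
    AbsolutelyContinuousOnInterval (fun t => φ (f t)) a b :=
  absolutelyContinuous_comp_lipschitzOn hf φ.lipschitz.lipschitzOnWith

theorem absolutelyContinuous_const {X : Type*} [PseudoMetricSpace X] (x : X) (a b : ℝ) :
    AbsolutelyContinuousOnInterval (fun _ => x) a b :=
  (LipschitzWith.const x).lipschitzOnWith.absolutelyContinuousOnInterval

theorem absolutelyContinuous_sum {ι F : Type*} [SeminormedAddCommGroup F] {f : ι → ℝ → F}
    {a b : ℝ} (s : Finset ι) (hf : ∀ i ∈ s, AbsolutelyContinuousOnInterval (f i) a b) :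
    AbsolutelyContinuousOnInterval (fun t => ∑ i ∈ s, f i t) a b := by
  classical
  induction s using Finset.induction_on with
  | empty => simpa using absolutelyContinuous_const (0 : F) a b
  | insert i s his ih =>
    simp only [Finset.sum_insert his]
    exact (hf i (by simp)).fun_add (ih fun j hj => hf j (by simp [hj]))

theorem absolutelyContinuous_pi {ι : Type*} [Fintype ι] {f : ℝ → ι → ℝ} {a b : ℝ}
    (hf : ∀ i, AbsolutelyContinuousOnInterval (fun t => f t i) a b) :
    AbsolutelyContinuousOnInterval f a b := by
  classical
  have h := absolutelyContinuous_sum Finset.univ fun i _ =>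
    absolutelyContinuous_clm (hf i) (ContinuousLinearMap.single ℝ (fun _ : ι => ℝ) i)
  have he : f = fun t => ∑ i, ContinuousLinearMap.single ℝ (fun _ : ι => ℝ) i (f t i) := by
    funext t
    simp [Finset.univ_sum_single]
  rw [he]
  exact h

theorem le_of_ae_deriv_nonpos {g : ℝ → ℝ} {a b : ℝ} (hab : a ≤ b)
    (hg : AbsolutelyContinuousOnInterval g a b)
    (hd : ∀ᵐ t : ℝ, t ∈ Ioo a b → ∃ g', HasDerivAt g g' t ∧ g' ≤ 0) : g b ≤ g a := by
  have h := hg.integral_deriv_eq_sub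
  have hle : ∫ x in a..b, deriv g x ≤ 0 := by
    rw [intervalIntegral.integral_of_le hab]
    refine integral_nonpos_of_ae ?_
    rw [EventuallyLE, ae_restrict_iff' measurableSet_Ioc]
    have hb : ∀ᵐ t : ℝ, t ≠ b := by simp [ae_iff, measure_singleton]
    filter_upwards [hd, hb] with t ht htb htm
    obtain ⟨g', h1, h2⟩ := ht ⟨htm.1, lt_of_le_of_ne htm.2 htb⟩
    rw [h1.deriv]
    exact h2
  linarith

theorem antitoneOn_of_ae_deriv_nonpos {g : ℝ → ℝ} {a : ℝ}
    (hg : ∀ T, a ≤ T → AbsolutelyContinuousOnInterval g a T)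
    (hd : ∀ᵐ t : ℝ, a < t → ∃ g', HasDerivAt g g' t ∧ g' ≤ 0) : AntitoneOn g (Ici a) := by
  intro s hs t ht hst
  refine le_of_ae_deriv_nonpos hst ((hg t ht).mono ?_) ?_
  · rw [uIcc_of_le hst, uIcc_of_le ht]
    exact Icc_subset_Icc_left hs
  · filter_upwards [hd] with r hr hrm
    exact hr (lt_of_le_of_lt hs hrm.1)

theorem absolutelyContinuous_exp (c a b : ℝ) :
    AbsolutelyContinuousOnInterval (fun t => Real.exp (c * t)) a b :=
  ContDiffOn.absolutelyContinuousOnInterval (by fun_prop)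

/-- Grönwall: the factor `exp (-M t)` turns the inequality into monotonicity. The next lemma is its
time reversal; having both gives uniqueness for linear equations in both time directions. -/
theorem le_zero_of_ae_deriv_le {g : ℝ → ℝ} {a b M : ℝ} (hab : a ≤ b)
    (hg : AbsolutelyContinuousOnInterval g a b)
    (hd : ∀ᵐ t : ℝ, t ∈ Ioo a b → ∃ g', HasDerivAt g g' t ∧ g' ≤ M * g t) (ha : g a ≤ 0) :
    g b ≤ 0 := by
  have h := le_of_ae_deriv_nonpos hab ((absolutelyContinuous_exp (-M) a b).fun_mul hg) (by
    filter_upwards [hd] with t ht htm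
    obtain ⟨g', h1, h2⟩ := ht htm
    refine ⟨_, ((((hasDerivAt_id t).const_mul (-M)).exp).mul h1), ?_⟩
    have := Real.exp_pos (-M * t)
    simp only [id, mul_one]
    nlinarith)
  have h1 := Real.exp_pos (-M * a)
  have h2 := Real.exp_pos (-M * b)
  have h3 : Real.exp (-M * b) * g b ≤ 0 := h.trans (mul_nonpos_of_nonneg_of_nonpos h1.le ha)
  exact nonpos_of_mul_nonpos_right h3 h2

theorem le_zero_of_le_ae_deriv {g : ℝ → ℝ} {a b M : ℝ} (hab : a ≤ b)
    (hg : AbsolutelyContinuousOnInterval g a b)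
    (hd : ∀ᵐ t : ℝ, t ∈ Ioo a b → ∃ g', HasDerivAt g g' t ∧ -(M * g t) ≤ g') (hb : g b ≤ 0) :
    g a ≤ 0 := by
  have h := le_of_ae_deriv_nonpos hab ((absolutelyContinuous_exp M a b).fun_mul hg).fun_neg (by
    filter_upwards [hd] with t ht htm
    obtain ⟨g', h1, h2⟩ := ht htm
    refine ⟨_, ((((hasDerivAt_id t).const_mul M).exp).mul h1).neg, ?_⟩
    have := Real.exp_pos (M * t)
    simp only [id, mul_one]
    nlinarith)
  have h1 := Real.exp_pos (M * a)
  have h2 := Real.exp_pos (M * b)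
  have h3 : Real.exp (M * a) * g a ≤ 0 := by
    have := mul_nonpos_of_nonneg_of_nonpos h2.le hb
    linarith
  exact nonpos_of_mul_nonpos_right h3 h1

/-! ### Primitives -/

theorem intervalIntegrable_of_locallyIntegrableOn {E : Type*} [NormedAddCommGroup E] {f : ℝ → E}
    (hf : LocallyIntegrableOn f (Ici 0)) {s t : ℝ} (hs : 0 ≤ s) (ht : 0 ≤ t) :
    IntervalIntegrable f volume s t := by
  rw [intervalIntegrable_iff']
  refine hf.integrableOn_compact_subset ?_ isCompact_uIcc
  intro r hr
  exact le_trans (le_min hs ht) hr.1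

theorem ae_hasDerivAt_primitive {E : Type*} [NormedAddCommGroup E] [NormedSpace ℝ E]
    [CompleteSpace E] {f : ℝ → E} (hf : LocallyIntegrableOn f (Ici 0)) :
    ∀ᵐ t : ℝ, 0 < t → HasDerivAt (fun s => ∫ r in (0 : ℝ)..s, f r) (f t) t := by
  -- Differentiability almost everywhere is known on compact intervals; countably many of them
  -- exhaust the half-line.
  have h : ∀ N : ℕ, ∀ᵐ t : ℝ, t ∈ uIcc (0 : ℝ) N → ∀ c ∈ uIcc (0 : ℝ) N,
      HasDerivAt (fun s => ∫ r in c..s, f r) (f t) t := fun N =>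
    (intervalIntegrable_of_locallyIntegrableOn hf le_rfl N.cast_nonneg).ae_hasDerivAt_integral
  filter_upwards [ae_all_iff.2 h] with t ht h0
  obtain ⟨N, hN⟩ := exists_nat_ge t
  refine ht N ?_ 0 left_mem_uIcc
  rw [uIcc_of_le N.cast_nonneg]
  exact ⟨h0.le, hN⟩

theorem absolutelyContinuous_primitive {f : ℝ → ℝ} (hf : LocallyIntegrableOn f (Ici 0)) {T : ℝ}
    (hT : 0 ≤ T) : AbsolutelyContinuousOnInterval (fun s => ∫ r in (0 : ℝ)..s, f r) 0 T :=
  (intervalIntegrable_of_locallyIntegrableOn hf le_rfl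
    hT).absolutelyContinuousOnInterval_intervalIntegral left_mem_uIcc

theorem locallyIntegrableOn_clm {E F : Type*} [NormedAddCommGroup E] [NormedSpace ℝ E]
    [NormedAddCommGroup F] [NormedSpace ℝ F] {f : ℝ → E} {s : Set ℝ}
    (hf : LocallyIntegrableOn f s) (φ : E →L[ℝ] F) :
    LocallyIntegrableOn (fun t => φ (f t)) s := fun t ht => by
  obtain ⟨U, hU, h⟩ := hf t ht
  exact ⟨U, hU, φ.integrable_comp h⟩

theorem absolutelyContinuous_primitive_pi {ι : Type*} [Fintype ι] {f : ℝ → ι → ℝ}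
    (hf : LocallyIntegrableOn f (Ici 0)) {T : ℝ} (hT : 0 ≤ T) :
    AbsolutelyContinuousOnInterval (fun s => ∫ r in (0 : ℝ)..s, f r) 0 T := by
  refine absolutelyContinuous_pi fun i => ?_
  have hi : LocallyIntegrableOn (fun t => f t i) (Ici 0) :=
    locallyIntegrableOn_clm hf (ContinuousLinearMap.proj (R := ℝ) (φ := fun _ : ι => ℝ) i)
  have h := absolutelyContinuous_primitive hi hT
  have hco : ∀ s ∈ Icc (0 : ℝ) T, (∫ r in (0 : ℝ)..s, f r) i = ∫ r in (0 : ℝ)..s, f r i :=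
    fun s hs => ((ContinuousLinearMap.proj (R := ℝ) (φ := fun _ : ι => ℝ)
      i).intervalIntegral_comp_comm
        (intervalIntegrable_of_locallyIntegrableOn hf le_rfl hs.1)).symm
  -- Coordinates commute with the integral only for endpoints in `[0, T]`, since nothing is known of
  -- `f` at negative times. The two functions need not be equal, so the transfer is made through the
  -- `ε`-`δ` form, which sees only that interval.
  rw [absolutelyContinuousOnInterval_iff] at h ⊢
  intro ε hε
  obtain ⟨δ, hδ, hE⟩ := h ε hε
  refine ⟨δ, hδ, fun E hm hl => ?_⟩
  refine lt_of_le_of_lt (Finset.sum_le_sum fun j hj => ?_) (hE E hm hl)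
  have := hm.1 j hj
  rw [uIcc_of_le hT] at this
  rw [hco _ this.1, hco _ this.2]

/-! ### Linear differential equations -/

/-- Grönwall for the squared Euclidean norm, forwards and backwards from `s`. The backward half is
what makes transition matrices invertible. -/
theorem eq_zero_of_linear_ode {ι : Type*} [Fintype ι] {L : ℝ → Matrix ι ι ℝ} {ξ : ℝ → ι → ℝ}
    {a b s C : ℝ} (hL : ∀ᵐ t : ℝ, t ∈ Icc a b → ∀ i j, |L t i j| ≤ C)
    (hξ : AbsolutelyContinuousOnInterval ξ a b)
    (hd : ∀ᵐ t : ℝ, t ∈ Ioo a b → HasDerivAt ξ (-((L t).mulVec (ξ t))) t)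
    (hs : s ∈ Icc a b) (h0 : ξ s = 0) : ∀ t ∈ Icc a b, ξ t = 0 := by
  classical
  set g : ℝ → ℝ := fun t => ∑ i, ξ t i * ξ t i with hgdef
  have hco : ∀ i, AbsolutelyContinuousOnInterval (fun t => ξ t i) a b := fun i =>
    absolutelyContinuous_clm hξ (ContinuousLinearMap.proj (R := ℝ) (φ := fun _ : ι => ℝ) i)
  have hg : AbsolutelyContinuousOnInterval g a b :=
    absolutelyContinuous_sum _ fun i _ => (hco i).fun_mul (hco i)
  -- From `2 |ξ_i ξ_j| ≤ ξ_i² + ξ_j²`, summed over all pairs with `|L i j| ≤ C`.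
  set M : ℝ := 2 * C * Fintype.card ι
  have hd' : ∀ᵐ t : ℝ, t ∈ Ioo a b → ∃ g', HasDerivAt g g' t ∧ |g'| ≤ M * g t := by
    filter_upwards [hd, hL] with t ht hLt htm
    have hLt := hLt ⟨htm.1.le, htm.2.le⟩
    have hti := hasDerivAt_pi.1 (ht htm)
    refine ⟨_, HasDerivAt.fun_sum fun i _ => (hti i).mul (hti i), ?_⟩
    have e : ∀ i, (-(L t).mulVec (ξ t)) i * ξ t i + ξ t i * (-(L t).mulVec (ξ t)) i
        = ∑ j, -(2 * L t i j * (ξ t i * ξ t j)) := by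
      intro i
      simp only [Pi.neg_apply, Matrix.mulVec, dotProduct]
      rw [← Finset.sum_neg_distrib, Finset.sum_mul, Finset.mul_sum, ← Finset.sum_add_distrib]
      exact Finset.sum_congr rfl fun j _ => by ring
    calc |∑ i, ((-(L t).mulVec (ξ t)) i * ξ t i + ξ t i * (-(L t).mulVec (ξ t)) i)|
        ≤ ∑ i, ∑ j, C * (ξ t i * ξ t i + ξ t j * ξ t j) := by
          refine (Finset.abs_sum_le_sum_abs _ _).trans (Finset.sum_le_sum fun i _ => ?_)
          rw [e i]
          refine (Finset.abs_sum_le_sum_abs _ _).trans (Finset.sum_le_sum fun j _ => ?_)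
          rw [abs_neg, abs_mul, abs_mul, abs_two]
          have h1 : |ξ t i * ξ t j| * 2 ≤ ξ t i * ξ t i + ξ t j * ξ t j := by
            rcases abs_cases (ξ t i * ξ t j) with h | h <;>
              nlinarith [sq_nonneg (ξ t i - ξ t j), sq_nonneg (ξ t i + ξ t j)]
          have h2 := hLt i j
          nlinarith [abs_nonneg (ξ t i * ξ t j), abs_nonneg (L t i j)]
      _ = M * g t := by
          simp only [mul_add, Finset.sum_add_distrib, Finset.sum_const, Finset.card_univ,
            nsmul_eq_mul, ← Finset.mul_sum, M, hgdef]
          ring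
  have hsub : ∀ {c d : ℝ}, c ≤ d → a ≤ c → d ≤ b → AbsolutelyContinuousOnInterval g c d := by
    intro c d hcd hc hd
    refine hg.mono ?_
    rw [uIcc_of_le hcd, uIcc_of_le (hc.trans (hcd.trans hd))]
    exact Icc_subset_Icc hc hd
  have hgs : g s = 0 := by simp [hgdef, h0]
  intro t ht
  have hgt : g t ≤ 0 := by
    rcases le_total s t with hst | hts
    · refine le_zero_of_ae_deriv_le (M := M) hst (hsub hst hs.1 ht.2) ?_ hgs.le
      filter_upwards [hd'] with r hr hrm
      obtain ⟨g', h1, h2⟩ := hr ⟨lt_of_le_of_lt hs.1 hrm.1, lt_of_lt_of_le hrm.2 ht.2⟩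
      exact ⟨g', h1, (abs_le.1 h2).2⟩
    · refine le_zero_of_le_ae_deriv (M := M) hts (hsub hts ht.1 hs.2) ?_ hgs.le
      filter_upwards [hd'] with r hr hrm
      obtain ⟨g', h1, h2⟩ := hr ⟨lt_of_le_of_lt ht.1 hrm.1, lt_of_lt_of_le hrm.2 hs.2⟩
      exact ⟨g', h1, (abs_le.1 h2).1⟩
  have h := (Finset.sum_eq_zero_iff_of_nonneg fun i _ => mul_self_nonneg (ξ t i)).1
    (le_antisymm hgt (Finset.sum_nonneg fun i _ => mul_self_nonneg (ξ t i)))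
  funext i
  exact mul_self_eq_zero.1 (h i (Finset.mem_univ i))

/-! ### The transition matrix -/

theorem IsCaratheodorySolution.mono {E : Type*} [NormedAddCommGroup E] [NormedSpace ℝ E]
    {g : ℝ → E → E} {r s : ℝ} {x : ℝ → E} (hx : IsCaratheodorySolution g r x) (hrs : r ≤ s) :
    IsCaratheodorySolution g s x := by
  refine ⟨fun T hT => (hx.1 T (hrs.trans hT)).mono ?_, ?_⟩
  · rw [uIcc_of_le hT, uIcc_of_le (hrs.trans hT)]
    exact Icc_subset_Icc_left hrs
  · filter_upwards [hx.2] with t ht hst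
    exact ht (lt_of_le_of_lt hrs hst)

/-- Evaluation of a matrix at a vector, as a continuous linear map in the matrix. -/
noncomputable def mulVecRight {n : ℕ} (v : Fin n → ℝ) :
    Matrix (Fin n) (Fin n) ℝ →L[ℝ] (Fin n → ℝ) :=
  LinearMap.toContinuousLinearMap
    { toFun := fun A => A.mulVec v
      map_add' := fun A B => Matrix.add_mulVec A B v
      map_smul' := fun c A => Matrix.smul_mulVec c A v }

section

variable {n : ℕ} {L : ℝ → Matrix (Fin n) (Fin n) ℝ} {Φ : ℝ → ℝ → Matrix (Fin n) (Fin n) ℝ}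

theorem IsFlow.mulVec_solution (hΦ : IsFlow L Φ) {s : ℝ} (hs : 0 ≤ s) (v : Fin n → ℝ) :
    IsCaratheodorySolution (fun t y => -((L t).mulVec y)) s (fun t => (Φ t s).mulVec v) := by
  obtain ⟨-, hac, hd⟩ := hΦ s hs
  refine ⟨fun T hT => absolutelyContinuous_clm (hac T hT) (mulVecRight v), ?_⟩
  filter_upwards [hd] with t ht hst
  have h : HasDerivAt (fun t => (Φ t s).mulVec v) ((-(L t * Φ t s)).mulVec v) t :=
    (mulVecRight v).hasFDerivAt.comp_hasDerivAt t (ht hst)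
  rw [Matrix.neg_mulVec, ← Matrix.mulVec_mulVec] at h
  exact h

theorem caratheodorySolution_zero (hL : IsLaplacianProcess L) {r s t : ℝ} (hr : 0 ≤ r)
    {ξ : ℝ → Fin n → ℝ} (hξ : IsCaratheodorySolution (fun t y => -((L t).mulVec y)) r ξ)
    (hs : r ≤ s) (ht : r ≤ t) (h0 : ξ s = 0) : ξ t = 0 := by
  obtain ⟨C, hC⟩ := hL.locally_ess_bounded (max s t)
  refine eq_zero_of_linear_ode (L := L) (a := r) (b := max s t) (s := s) (C := C) ?_
    (hξ.1 _ (hs.trans (le_max_left _ _))) ?_ ⟨hs, le_max_left _ _⟩ h0 t ⟨ht, le_max_right _ _⟩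
  · filter_upwards [hC] with τ hτ hm
    exact hτ ⟨hr.trans hm.1, hm.2⟩
  · filter_upwards [hξ.2] with τ hτ hm
    exact hτ hm.1

theorem IsFlow.eq_mulVec (hL : IsLaplacianProcess L) (hΦ : IsFlow L Φ) {s t : ℝ} (hs : 0 ≤ s)
    (hst : s ≤ t) {ξ : ℝ → Fin n → ℝ}
    (hξ : IsCaratheodorySolution (fun t y => -((L t).mulVec y)) s ξ) :
    ξ t = (Φ t s).mulVec (ξ s) := by
  have hη := hΦ.mulVec_solution hs (ξ s)
  have h := caratheodorySolution_zero hL hs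
    (ξ := fun t => ξ t - (Φ t s).mulVec (ξ s)) ⟨fun T hT => (hξ.1 T hT).fun_sub (hη.1 T hT), ?_⟩
    le_rfl hst (by simp [(hΦ s hs).1])
  · exact sub_eq_zero.1 h
  · filter_upwards [hξ.2, hη.2] with τ h1 h2 hm
    have := (h1 hm).sub (h2 hm)
    rw [Matrix.mulVec_sub, neg_sub]
    convert! this using 1
    abel

theorem IsFlow.mul_eq (hL : IsLaplacianProcess L) (hΦ : IsFlow L Φ) {r s t : ℝ} (hr : 0 ≤ r)
    (hrs : r ≤ s) (hst : s ≤ t) : Φ t s * Φ s r = Φ t r := by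
  refine Matrix.ext_of_mulVec_single fun j => ?_
  rw [← Matrix.mulVec_mulVec]
  exact (hΦ.eq_mulVec hL (hr.trans hrs) hst ((hΦ.mulVec_solution hr _).mono hrs)).symm

/-- A solution that vanishes at time `t` vanishes at time `s`, so the kernel is trivial. -/
theorem IsFlow.isUnit (hL : IsLaplacianProcess L) (hΦ : IsFlow L Φ) {s t : ℝ} (hs : 0 ≤ s)
    (hst : s ≤ t) : IsUnit (Φ t s) := by
  rw [← Matrix.mulVec_injective_iff_isUnit]
  intro v v' hv
  have h := caratheodorySolution_zero hL hs (hΦ.mulVec_solution hs (v - v')) hst le_rfl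
    (by rw [Matrix.mulVec_sub, sub_eq_zero]; exact hv)
  rw [(hΦ s hs).1, Matrix.one_mulVec, sub_eq_zero] at h
  exact h

theorem sum_mulVec_laplacian {A : Matrix (Fin n) (Fin n) ℝ} (hA : IsGeneralizedLaplacian A)
    (v : Fin n → ℝ) : ∑ i, A.mulVec v i = 0 := by
  simp only [Matrix.mulVec, dotProduct]
  rw [Finset.sum_comm]
  simp [← Finset.sum_mul, hA.2]

/-- The transition matrices have unit column sums. -/
theorem IsFlow.sum_mulVec (hL : IsLaplacianProcess L) (hΦ : IsFlow L Φ) {s t : ℝ} (hs : 0 ≤ s)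
    (hst : s ≤ t) (v : Fin n → ℝ) : ∑ i, (Φ t s).mulVec v i = ∑ i, v i := by
  obtain ⟨hac, hd⟩ := hΦ.mulVec_solution hs v
  set σ : ℝ → ℝ := fun r => ∑ i, (Φ r s).mulVec v i with hσ
  have hσac : AbsolutelyContinuousOnInterval σ s t := absolutelyContinuous_sum _ fun i _ =>
    absolutelyContinuous_clm (hac t hst) (ContinuousLinearMap.proj (R := ℝ)
      (φ := fun _ : Fin n => ℝ) i)
  have hσd : ∀ᵐ r : ℝ, r ∈ Ioo s t → HasDerivAt σ 0 r := by
    filter_upwards [hd] with r hr hm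
    have h := HasDerivAt.fun_sum (u := Finset.univ) fun i _ => hasDerivAt_pi.1 (hr hm.1) i
    convert! h using 1
    simp only [Pi.neg_apply, Finset.sum_neg_distrib,
      sum_mulVec_laplacian (hL.laplacian r (hs.trans hm.1.le)), neg_zero]
  have h1 := le_of_ae_deriv_nonpos hst hσac (by
    filter_upwards [hσd] with r hr hm using ⟨0, hr hm, le_rfl⟩)
  have h2 := le_of_ae_deriv_nonpos hst hσac.fun_neg (by
    filter_upwards [hσd] with r hr hm using ⟨-0, (hr hm).neg, by simp⟩)
  have h3 : σ s = ∑ i, v i := by simp [hσ, (hΦ s hs).1]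
  change σ t = _
  linarith

theorem IsFlow.continuousOn (hΦ : IsFlow L Φ) {s T : ℝ} (hs : 0 ≤ s) (hsT : s ≤ T) :
    ContinuousOn (fun t => Φ t s) (Icc s T) := by
  have := ((hΦ s hs).2.1 T hsT).continuousOn
  rwa [uIcc_of_le hsT] at this

theorem IsFlow.continuousOn_inv (hL : IsLaplacianProcess L) (hΦ : IsFlow L Φ) {T : ℝ}
    (hT : 0 ≤ T) : ContinuousOn (fun t => (Φ t 0)⁻¹) (Icc 0 T) := by
  have hc := hΦ.continuousOn le_rfl hT
  have hdet : ContinuousOn (fun t => (Φ t 0).det) (Icc 0 T) :=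
    (Continuous.matrix_det continuous_id).comp_continuousOn hc
  have hadj : ContinuousOn (fun t => (Φ t 0).adjugate) (Icc 0 T) :=
    (Continuous.matrix_adjugate continuous_id).comp_continuousOn hc
  simp only [Matrix.inv_def, Ring.inverse_eq_inv']
  refine ContinuousOn.smul (hdet.inv₀ fun t ht => ?_) hadj
  exact ((Matrix.isUnit_iff_isUnit_det _).1 (hΦ.isUnit hL le_rfl ht.1)).ne_zero

theorem locallyIntegrableOn_inv_mulVec (hL : IsLaplacianProcess L) (hΦ : IsFlow L Φ)
    {υ : ℝ → Fin n → ℝ} (hυ : LocallyIntegrableOn υ (Ici 0)) :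
    LocallyIntegrableOn (fun t => ((Φ t 0)⁻¹).mulVec (υ t)) (Ici 0) := by
  have hcomp : ∀ T : ℝ, 0 ≤ T →
      IntegrableOn (fun t => ((Φ t 0)⁻¹).mulVec (υ t)) (Icc 0 T) := by
    intro T hT
    have hinv := hΦ.continuousOn_inv hL hT
    have hυi : ∀ j, IntegrableOn (fun t => υ t j) (Icc 0 T) := fun j =>
      (ContinuousLinearMap.proj (R := ℝ) (φ := fun _ : Fin n => ℝ) j).integrable_comp
        (hυ.integrableOn_compact_subset Icc_subset_Ici_self isCompact_Icc)
    refine Integrable.of_eval fun i => ?_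
    simp only [Matrix.mulVec, dotProduct]
    refine integrable_finsetSum _ fun j _ => ?_
    have hij : ContinuousOn (fun t => (Φ t 0)⁻¹ i j) (Icc 0 T) :=
      (continuous_id.matrix_elem i j).comp_continuousOn hinv
    exact (hυi j).continuousOn_mul hij isCompact_Icc
  intro t ht
  refine ⟨Icc 0 (t + 1), ?_, hcomp _ (by linarith [mem_Ici.1 ht])⟩
  have : Icc 0 (t + 1) = Ici 0 ∩ Iic (t + 1) := rfl
  rw [this]
  exact inter_mem_nhdsWithin _ (Iic_mem_nhds (by linarith))

/-- Variation of constants. -/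
theorem IsFlow.variation_of_constants (hL : IsLaplacianProcess L) (hΦ : IsFlow L Φ)
    {υ ξ : ℝ → Fin n → ℝ} (hυ : LocallyIntegrableOn υ (Ici 0))
    (hξ : IsCaratheodorySolution (fun t y => -((L t).mulVec y) + υ t) 0 ξ) {T : ℝ}
    (hT : 0 ≤ T) :
    IntervalIntegrable (fun s => (Φ T s).mulVec (υ s)) volume 0 T ∧
      ξ T = (Φ T 0).mulVec (ξ 0) + ∫ s in (0 : ℝ)..T, (Φ T s).mulVec (υ s) := by
  -- Nothing is assumed on how `Φ(T, s)` depends on `s`. All of it is routed through `Φ(T, s) = Φ(T,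
  -- 0) Φ(s, 0)⁻¹`, where the inverse is continuous in `s`; this also gives the integrability claim.
  set ζ : ℝ → Fin n → ℝ := fun t => ((Φ t 0)⁻¹).mulVec (υ t) with hζdef
  have hζ : LocallyIntegrableOn ζ (Ici 0) := locallyIntegrableOn_inv_mulVec hL hΦ hυ
  set J : ℝ → Fin n → ℝ := fun t => ξ 0 + ∫ s in (0 : ℝ)..t, ζ s with hJdef
  obtain ⟨-, hΦac, hΦd⟩ := hΦ 0 le_rfl
  have hJac : ∀ S, 0 ≤ S → AbsolutelyContinuousOnInterval J 0 S := fun S hS =>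
    (absolutelyContinuous_const _ _ _).fun_add (absolutelyContinuous_primitive_pi hζ hS)
  have hJd : ∀ᵐ t : ℝ, 0 < t → HasDerivAt J (ζ t) t := by
    filter_upwards [ae_hasDerivAt_primitive hζ] with t ht h0
    exact (ht h0).const_add _
  have hunit : ∀ t, 0 ≤ t → IsUnit (Φ t 0).det := fun t ht =>
    (Matrix.isUnit_iff_isUnit_det _).1 (hΦ.isUnit hL le_rfl ht)
  have hη : IsCaratheodorySolution (fun t y => -((L t).mulVec y) + υ t) 0
      (fun t => (Φ t 0).mulVec (J t)) := by
    have hentry : ∀ i j, ∀ S, 0 ≤ S → AbsolutelyContinuousOnInterval (fun t => Φ t 0 i j) 0 S :=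
      fun i j S hS => absolutelyContinuous_clm (hΦac S hS)
        (Matrix.entryLinearMap ℝ ℝ i j).toContinuousLinearMap
    refine ⟨fun S hS => absolutelyContinuous_pi fun i => ?_, ?_⟩
    · simp only [Matrix.mulVec, dotProduct]
      exact absolutelyContinuous_sum _ fun j _ => (hentry i j S hS).fun_mul
        (absolutelyContinuous_clm (hJac S hS) (ContinuousLinearMap.proj (R := ℝ)
          (φ := fun _ : Fin n => ℝ) j))
    · filter_upwards [hΦd, hJd] with t h1 h2 h0
      refine hasDerivAt_pi.2 fun i => ?_
      have hij : ∀ j, HasDerivAt (fun t => Φ t 0 i j) ((-(L t * Φ t 0)) i j) t := fun j =>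
        ((Matrix.entryLinearMap ℝ ℝ i j).toContinuousLinearMap).hasFDerivAt.comp_hasDerivAt t
          (h1 h0)
      have hsum := HasDerivAt.fun_sum (u := Finset.univ) fun j _ =>
        (hij j).mul (hasDerivAt_pi.1 (h2 h0) j)
      have he : -((L t).mulVec ((Φ t 0).mulVec (J t))) + υ t
          = (-(L t * Φ t 0)).mulVec (J t) + (Φ t 0).mulVec (ζ t) := by
        rw [Matrix.neg_mulVec, Matrix.mulVec_mulVec, hζdef]
        simp only [Matrix.mulVec_mulVec]
        rw [Matrix.mul_nonsing_inv _ (hunit t h0.le), Matrix.one_mulVec]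
      rw [he]
      convert! hsum using 1
      simp only [Pi.add_apply, Matrix.mulVec, dotProduct, Finset.sum_add_distrib]
  have hdiff := caratheodorySolution_zero hL le_rfl
    (ξ := fun t => ξ t - (Φ t 0).mulVec (J t)) ⟨fun S hS => (hξ.1 S hS).fun_sub (hη.1 S hS), by
      filter_upwards [hξ.2, hη.2] with t h1 h2 h0
      have := (h1 h0).sub (h2 h0)
      rw [Matrix.mulVec_sub, neg_sub]
      convert! this using 1
      abel⟩ le_rfl hT (by simp [hJdef, (hΦ 0 le_rfl).1])
  have hζT : IntervalIntegrable ζ volume 0 T :=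
    intervalIntegrable_of_locallyIntegrableOn hζ le_rfl hT
  have hcongr : ∀ s ∈ Icc 0 T, (Φ T 0).mulVec (ζ s) = (Φ T s).mulVec (υ s) := by
    intro s hs
    rw [hζdef]
    simp only [Matrix.mulVec_mulVec]
    rw [← hΦ.mul_eq hL le_rfl hs.1 hs.2, Matrix.mul_assoc,
      Matrix.mul_nonsing_inv _ (hunit s hs.1), Matrix.mul_one]
  have hmap : (Φ T 0).mulVec (∫ s in (0 : ℝ)..T, ζ s)
      = ∫ s in (0 : ℝ)..T, (Φ T 0).mulVec (ζ s) :=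
    ((Matrix.mulVecLin (Φ T 0)).toContinuousLinearMap.intervalIntegral_comp_comm hζT).symm
  have hint : IntervalIntegrable (fun s => (Φ T 0).mulVec (ζ s)) volume 0 T :=
    ⟨(Matrix.mulVecLin (Φ T 0)).toContinuousLinearMap.integrable_comp hζT.1,
      (Matrix.mulVecLin (Φ T 0)).toContinuousLinearMap.integrable_comp hζT.2⟩
  refine ⟨hint.congr fun s hs => ?_, ?_⟩
  · rw [uIoc_of_le hT] at hs
    exact hcongr s ⟨hs.1.le, hs.2⟩
  · rw [sub_eq_zero.1 hdiff, hJdef]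
    simp only [Matrix.mulVec_add]
    rw [hmap]
    congr 1
    refine intervalIntegral.integral_congr fun s hs => ?_
    rw [uIcc_of_le hT] at hs
    exact hcongr s hs

end

/-! ### Ergodicity estimates -/

section

variable {n : ℕ} {L : ℝ → Matrix (Fin n) (Fin n) ℝ} {Φ : ℝ → ℝ → Matrix (Fin n) (Fin n) ℝ}

/-- Needed because `Metric.infDist` to the empty set is `0`, from which no nearby matrix could be
extracted. -/
theorem rankOneStochastic_nonempty (hn : 0 < n) : (rankOneStochastic n).Nonempty := by
  refine ⟨Matrix.vecMulVec (Pi.single ⟨0, hn⟩ 1) 1, ?_, _, rfl⟩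
  rw [Matrix.mem_colStochastic_iff_sum]
  refine ⟨fun i j => ?_, fun j => ?_⟩
  · simp only [Matrix.vecMulVec_apply, Pi.one_apply, mul_one, Pi.single_apply]
    split_ifs <;> norm_num
  · simp [Matrix.vecMulVec_apply]

theorem IsWeaklyExponentiallyErgodic.exists_bound (hn : 0 < n)
    (h : IsWeaklyExponentiallyErgodic Φ) :
    ∃ C lam : ℝ, 0 < C ∧ 0 < lam ∧ lam < 1 ∧ ∀ s t, 0 ≤ s → s ≤ t → ∃ π : Fin n → ℝ,
      (∀ i, |π i| ≤ 1) ∧ ∀ i j, |Φ t s i j - π i| ≤ C * lam ^ (t - s) := by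
  obtain ⟨a, lam, ha, h0, h1, hb⟩ := h
  -- The factor `2` makes the inequality strict, so that a matrix realizing it exists without an
  -- appeal to closedness.
  refine ⟨2 * a, lam, by positivity, h0, h1, fun s t hs hst => ?_⟩
  have hpos : 0 < lam ^ (t - s) := Real.rpow_pos_of_pos h0 _
  have hlt : Metric.infDist (Φ t s) (rankOneStochastic n) < 2 * a * lam ^ (t - s) :=
    lt_of_le_of_lt (hb s t hs hst) (by nlinarith [mul_pos ha hpos])
  obtain ⟨A, ⟨hA, π, rfl⟩, hd⟩ := (Metric.infDist_lt_iff (rankOneStochastic_nonempty hn)).1 hlt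
  have hA' := Matrix.mem_colStochastic_iff_sum.1 hA
  simp only [Matrix.vecMulVec_apply, Pi.one_apply, mul_one] at hA'
  refine ⟨π, fun i => ?_, fun i j => ?_⟩
  · rw [abs_of_nonneg (hA'.1 i ⟨0, hn⟩), ← hA'.2 ⟨0, hn⟩]
    exact Finset.single_le_sum (fun j _ => hA'.1 j ⟨0, hn⟩) (Finset.mem_univ i)
  · have := Matrix.norm_entry_le_entrywise_sup_norm (Φ t s - Matrix.vecMulVec π 1) (i := i) (j := j)
    rw [dist_eq_norm] at hd
    simp only [Matrix.sub_apply, Matrix.vecMulVec_apply, Pi.one_apply, mul_one,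
      Real.norm_eq_abs] at this
    exact this.trans hd.le

/-- The rows of `Φ(t, s)` are exponentially close to the normalized weights `w_i(t) / n`. -/
theorem IsFlow.exists_abs_sub_weight_le (hn : 0 < n) (hL : IsLaplacianProcess L)
    (hΦ : IsFlow L Φ) (hErg : IsWeaklyExponentiallyErgodic Φ) :
    ∃ C lam : ℝ, 0 < C ∧ 0 < lam ∧ lam < 1 ∧ ∀ s t, 0 ≤ s → s ≤ t → ∀ i j,
      |Φ t s i j - (Φ t 0).mulVec 1 i / n| ≤ C * lam ^ (t - s) := by
  obtain ⟨C, lam, hC, h0, h1, hb⟩ := hErg.exists_bound hn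
  have hn' : (0 : ℝ) < n := by exact_mod_cast hn
  refine ⟨C + C * (n * (1 + C)), lam, by positivity, h0, h1, fun s t hs hst i j => ?_⟩
  have hpos : 0 < lam ^ (t - s) := Real.rpow_pos_of_pos h0 _
  set w : Fin n → ℝ := (Φ s 0).mulVec 1 with hw
  have hwb : ∀ j, |w j| ≤ n * (1 + C) := by
    intro j
    obtain ⟨π, hπ, hΦπ⟩ := hb 0 s le_rfl hs
    have hpow : lam ^ (s - 0) ≤ 1 := Real.rpow_le_one h0.le h1.le (by linarith)
    have he : ∀ k, |Φ s 0 j k| ≤ 1 + C := fun k => by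
      have h2 := hΦπ j k
      have h3 := abs_sub_abs_le_abs_sub (Φ s 0 j k) (π j)
      nlinarith [hπ j]
    calc |w j| = |∑ k, Φ s 0 j k| := by simp [hw, Matrix.mulVec, dotProduct]
      _ ≤ ∑ k : Fin n, (1 + C) :=
        (Finset.abs_sum_le_sum_abs _ _).trans (Finset.sum_le_sum fun k _ => he k)
      _ = n * (1 + C) := by
        rw [Finset.sum_const, Finset.card_univ, Fintype.card_fin, nsmul_eq_mul]
  have hws : ∑ k, w k = n := by
    rw [hw, hΦ.sum_mulVec hL le_rfl hs]
    simp
  have hwt : (Φ t 0).mulVec 1 i = ∑ k, Φ t s i k * w k := by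
    rw [← hΦ.mul_eq hL le_rfl hs hst, ← Matrix.mulVec_mulVec]
    rfl
  obtain ⟨π, -, hΦπ⟩ := hb s t hs hst
  -- The weights `w(s)` sum to `n`, so `Φ(t,s) w(s) - n π` is the matrix error applied to a vector
  -- bounded uniformly in `s`.
  have hdiff : π i - (Φ t 0).mulVec 1 i / n = -(∑ k, (Φ t s i k - π i) * w k) / n := by
    have : ∑ k, (Φ t s i k - π i) * w k = (Φ t 0).mulVec 1 i - π i * n := by
      rw [hwt, ← hws, Finset.mul_sum, ← Finset.sum_sub_distrib]
      exact Finset.sum_congr rfl fun k _ => by ring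
    rw [this]
    field_simp
    ring
  have h4 : |π i - (Φ t 0).mulVec 1 i / n| ≤ C * (n * (1 + C)) * lam ^ (t - s) := by
    rw [hdiff, abs_div, abs_neg, abs_of_pos hn', div_le_iff₀ hn']
    calc |∑ k, (Φ t s i k - π i) * w k|
        ≤ ∑ k : Fin n, C * lam ^ (t - s) * (n * (1 + C)) := by
          refine (Finset.abs_sum_le_sum_abs _ _).trans (Finset.sum_le_sum fun k _ => ?_)
          rw [abs_mul]
          exact mul_le_mul (hΦπ i k) (hwb k) (abs_nonneg _) (by positivity)
      _ = C * (n * (1 + C)) * lam ^ (t - s) * n := by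
          simp
          ring
  calc |Φ t s i j - (Φ t 0).mulVec 1 i / n|
      ≤ |Φ t s i j - π i| + |π i - (Φ t 0).mulVec 1 i / n| := abs_sub_le _ _ _
    _ ≤ C * lam ^ (t - s) + C * (n * (1 + C)) * lam ^ (t - s) := add_le_add (hΦπ i j) h4
    _ = _ := by ring

theorem intervalIntegrable_rpow_mul_norm {E : Type*} [NormedAddCommGroup E] {f : ℝ → E}
    (hf : LocallyIntegrableOn f (Ici 0)) {lam T : ℝ} (hlam : 0 < lam) (hT : 0 ≤ T) :
    IntervalIntegrable (fun s => lam ^ (T - s) * ‖f s‖) volume 0 T := by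
  refine (intervalIntegrable_of_locallyIntegrableOn hf le_rfl hT).norm.continuousOn_mul ?_
  exact (Continuous.rpow continuous_const (by fun_prop) fun _ => Or.inl hlam.ne').continuousOn

/-- Scalar version of the flow-tracking estimate. -/
theorem IsFlow.exists_tracking_bound (hn : 0 < n) (hL : IsLaplacianProcess L)
    (hΦ : IsFlow L Φ) (hErg : IsWeaklyExponentiallyErgodic Φ) :
    ∃ c lam : ℝ, 0 < c ∧ 0 < lam ∧ lam < 1 ∧ ∀ υ ξ : ℝ → Fin n → ℝ,
      LocallyIntegrableOn υ (Ici 0) →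
      IsCaratheodorySolution (fun t y => -((L t).mulVec y) + υ t) 0 ξ → ∀ T, 0 ≤ T → ∀ i,
      |ξ T i - (Φ T 0).mulVec 1 i * ((n : ℝ)⁻¹ * ∑ j, ξ T j)| ≤
        c * (lam ^ T * ‖ξ 0‖ + ∫ s in (0 : ℝ)..T, lam ^ (T - s) * ‖υ s‖) := by
  obtain ⟨C, lam, hC, h0, h1, hb⟩ := hΦ.exists_abs_sub_weight_le hn hL hErg
  have hn' : (0 : ℝ) < n := by exact_mod_cast hn
  refine ⟨n * C, lam, by positivity, h0, h1, fun υ ξ hυ hξ T hT i => ?_⟩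
  obtain ⟨hint, hvar⟩ := hΦ.variation_of_constants hL hυ hξ hT
  set W := (Φ T 0).mulVec 1 i with hW
  -- The weight is frozen at the final time, so the tracking error is a fixed linear functional and
  -- passes under the integral. By mass conservation its composition with `Φ(T, s)` has coefficients
  -- `Φ T s i j - W / n`.
  let ℓ : (Fin n → ℝ) →L[ℝ] ℝ := ContinuousLinearMap.proj (R := ℝ) (φ := fun _ : Fin n => ℝ) i
    - (W * (n : ℝ)⁻¹) • ∑ j, ContinuousLinearMap.proj (R := ℝ) (φ := fun _ : Fin n => ℝ) j
  have hℓ : ∀ v, ℓ v = v i - W * ((n : ℝ)⁻¹ * ∑ j, v j) := by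
    intro v
    simp only [ℓ, sub_apply, smul_apply, sum_apply, ContinuousLinearMap.proj_apply, smul_eq_mul]
    ring
  have hℓΦ : ∀ s ∈ Icc 0 T, ∀ v, |ℓ ((Φ T s).mulVec v)| ≤ n * C * (lam ^ (T - s) * ‖v‖) := by
    intro s hs v
    rw [hℓ, hΦ.sum_mulVec hL hs.1 hs.2]
    have he : (Φ T s).mulVec v i - W * ((n : ℝ)⁻¹ * ∑ j, v j)
        = ∑ j, (Φ T s i j - W / n) * v j := by
      simp only [Matrix.mulVec, dotProduct, sub_mul, Finset.sum_sub_distrib, ← Finset.mul_sum]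
      ring
    rw [he]
    calc |∑ j, (Φ T s i j - W / n) * v j|
        ≤ ∑ j : Fin n, C * lam ^ (T - s) * ‖v‖ := by
          refine (Finset.abs_sum_le_sum_abs _ _).trans (Finset.sum_le_sum fun j _ => ?_)
          rw [abs_mul]
          exact mul_le_mul (hb s T hs.1 hs.2 i j) (norm_le_pi_norm v j) (abs_nonneg _)
            (mul_nonneg hC.le (Real.rpow_nonneg h0.le _))
      _ = n * C * (lam ^ (T - s) * ‖v‖) := by
          simp
          ring
  rw [← hℓ, hvar, map_add, ← ℓ.intervalIntegral_comp_comm hint, mul_add]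
  refine (abs_add_le _ _).trans (add_le_add ?_ ?_)
  · have := hℓΦ 0 ⟨le_rfl, hT⟩ (ξ 0)
    rwa [sub_zero] at this
  · rw [← intervalIntegral.integral_const_mul]
    have hmono := intervalIntegral.norm_integral_le_of_norm_le hT
      (f := fun s => ℓ ((Φ T s).mulVec (υ s)))
      (g := fun s => n * C * (lam ^ (T - s) * ‖υ s‖)) (μ := volume)
      (Eventually.of_forall fun s hs => hℓΦ s ⟨hs.1.le, hs.2⟩ (υ s))
      ((intervalIntegrable_rpow_mul_norm hυ h0 hT).const_mul _)
    exact hmono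

end

/-! ### Trajectories of push-sum -/

section

variable {n d : ℕ} {L : ℝ → Matrix (Fin n) (Fin n) ℝ} {Φ : ℝ → ℝ → Matrix (Fin n) (Fin n) ℝ}
  {u x : ℝ → AgentVec n d} {w : ℝ → Fin n → ℝ}

theorem state_solution (h : (pushSum d L).IsTrajectory u x w) :
    IsCaratheodorySolution (fun t (y : AgentVec n d) i => -(∑ j, L t i j • y j) + u t i) 0 x := by
  refine ⟨fun T hT => absolutelyContinuous_clm (h.2.1 T hT)
    (ContinuousLinearMap.fst ℝ (AgentVec n d) (Fin n → ℝ)), ?_⟩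
  filter_upwards [h.2.2] with t ht h0
  exact (ContinuousLinearMap.fst ℝ (AgentVec n d) (Fin n → ℝ)).hasFDerivAt.comp_hasDerivAt t
    (ht h0)

theorem weight_solution (h : (pushSum d L).IsTrajectory u x w) :
    IsCaratheodorySolution (fun t y => -((L t).mulVec y)) 0 w := by
  refine ⟨fun T hT => absolutelyContinuous_clm (h.2.1 T hT)
    (ContinuousLinearMap.snd ℝ (AgentVec n d) (Fin n → ℝ)), ?_⟩
  filter_upwards [h.2.2] with t ht h0
  exact (ContinuousLinearMap.snd ℝ (AgentVec n d) (Fin n → ℝ)).hasFDerivAt.comp_hasDerivAt t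
    (ht h0)

theorem weight_eq (hL : IsLaplacianProcess L) (hΦ : IsFlow L Φ)
    (h : (pushSum d L).IsTrajectory u x w) (hQ : (x 0, w 0) ∈ pushSumInit n d) {t : ℝ}
    (ht : 0 ≤ t) : w t = (Φ t 0).mulVec 1 := by
  have hw0 : w 0 = 1 := hQ.2
  rw [← hw0]
  exact hΦ.eq_mulVec hL le_rfl ht (weight_solution h)

/-- The average, as a continuous linear map. -/
noncomputable def averageCLM (n d : ℕ) : AgentVec n d →L[ℝ] EuclideanSpace ℝ (Fin d) :=
  (n : ℝ)⁻¹ • ∑ i, ContinuousLinearMap.proj (R := ℝ) (φ := fun _ : Fin n =>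
    EuclideanSpace ℝ (Fin d)) i

theorem averageCLM_apply (y : AgentVec n d) : averageCLM n d y = average y := by
  simp [averageCLM, average]

theorem average_solution (hL : IsLaplacianProcess L) (h : (pushSum d L).IsTrajectory u x w) :
    IsCaratheodorySolution (fun t _ => average (u t)) 0 (fun t => average (x t)) := by
  obtain ⟨hac, hd⟩ := state_solution h
  simp only [← averageCLM_apply]
  refine ⟨fun T hT => absolutelyContinuous_clm (hac T hT) (averageCLM n d), ?_⟩
  filter_upwards [hd] with t ht h0
  have h1 := (averageCLM n d).hasFDerivAt.comp_hasDerivAt t (ht h0)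
  convert! h1 using 1
  rw [averageCLM_apply, averageCLM_apply, average, average]
  congr 1
  rw [Finset.sum_add_distrib, Finset.sum_neg_distrib, Finset.sum_comm]
  simp [← Finset.sum_smul, (hL.laplacian t h0.le).2]

/-- The `k`-th coordinates of all agents. -/
noncomputable def agentCoord (n : ℕ) {d : ℕ} (k : Fin d) : AgentVec n d →L[ℝ] (Fin n → ℝ) :=
  ContinuousLinearMap.pi fun i => (EuclideanSpace.proj k).comp
    (ContinuousLinearMap.proj (R := ℝ) (φ := fun _ : Fin n => EuclideanSpace ℝ (Fin d)) i)

theorem agentCoord_apply (k : Fin d) (y : AgentVec n d) (i : Fin n) :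
    agentCoord n k y i = y i k := rfl

theorem norm_agentCoord_le (k : Fin d) (y : AgentVec n d) : ‖agentCoord n k y‖ ≤ ‖y‖ :=
  (pi_norm_le_iff_of_nonneg (norm_nonneg _)).2 fun i =>
    (PiLp.norm_apply_le (y i) k).trans (norm_le_pi_norm y i)

theorem agentCoord_solution (h : (pushSum d L).IsTrajectory u x w) (k : Fin d) :
    IsCaratheodorySolution (fun t y => -((L t).mulVec y) + agentCoord n k (u t)) 0
      (fun t => agentCoord n k (x t)) := by
  obtain ⟨hac, hd⟩ := state_solution h
  refine ⟨fun T hT => absolutelyContinuous_clm (hac T hT) (agentCoord n k), ?_⟩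
  filter_upwards [hd] with t ht h0
  have h1 := (agentCoord n k).hasFDerivAt.comp_hasDerivAt t (ht h0)
  convert! h1 using 1
  funext i
  simp [agentCoord_apply, Matrix.mulVec, dotProduct]

theorem norm_le_sum_abs (v : EuclideanSpace ℝ (Fin d)) : ‖v‖ ≤ ∑ k, |v k| := by
  rw [EuclideanSpace.norm_eq]
  refine Real.sqrt_le_iff.2 ⟨Finset.sum_nonneg fun k _ => abs_nonneg _, ?_⟩
  simp only [Real.norm_eq_abs]
  exact Finset.sum_sq_le_sq_sum_of_nonneg fun k _ => abs_nonneg _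

theorem pushSum_weight_pos (hL : IsLaplacianProcess L) (hΦ : IsFlow L Φ) (hP : IsClassPStar Φ)
    (h : (pushSum d L).IsTrajectory u x w) (hQ : (x 0, w 0) ∈ pushSumInit n d) (t : ℝ)
    (ht : 0 ≤ t) (i : Fin n) : 0 < w t i := by
  obtain ⟨p, hp, hb⟩ := hP
  rw [weight_eq hL hΦ h hQ ht]
  exact hp.trans_le (hb 0 t le_rfl ht i)

theorem pushSum_isFlowTracker (hn : 0 < n) (hL : IsLaplacianProcess L) (hΦ : IsFlow L Φ)
    (hP : IsClassPStar Φ) (hErg : IsWeaklyExponentiallyErgodic Φ) :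
    (pushSum d L).IsFlowTracker (pushSumInit n d) := by
  obtain ⟨c, lam, hc, h0, h1, hb⟩ := hΦ.exists_tracking_bound hn hL hErg
  obtain ⟨p, hp, hpb⟩ := hP
  -- One bound `c * R` per coordinate; `d + 1` instead of `d` keeps the constant positive when `d =
  -- 0`. Division by a weight at least `p` costs `p⁻¹`.
  refine ⟨p⁻¹ * ((d + 1) * c), lam, by positivity, h0, h1, fun u x w h hQ =>
    ⟨average_solution hL h, fun t ht i => ?_⟩⟩
  have hw := weight_eq hL hΦ h hQ ht
  have hwi : p ≤ w t i := by
    rw [hw]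
    exact hpb 0 t le_rfl ht i
  have hwpos : 0 < w t i := hp.trans_le hwi
  set R := lam ^ t * ‖x 0‖ + ∫ τ in (0 : ℝ)..t, lam ^ (t - τ) * ‖u τ‖ with hR
  have hR0 : 0 ≤ R := add_nonneg (mul_nonneg (Real.rpow_nonneg h0.le _) (norm_nonneg _))
    (intervalIntegral.integral_nonneg ht fun τ _ =>
      mul_nonneg (Real.rpow_nonneg h0.le _) (norm_nonneg _))
  have hcoord : ∀ k, |(x t i - w t i • average (x t)) k| ≤ c * R := by
    intro k
    have hint := locallyIntegrableOn_clm h.1 (agentCoord n k)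
    have h2 := hb _ _ hint (agentCoord_solution h k) t ht i
    have he : (x t i - w t i • average (x t)) k = agentCoord n k (x t) i
        - (Φ t 0).mulVec 1 i * ((n : ℝ)⁻¹ * ∑ j, agentCoord n k (x t) j) := by
      rw [← hw]
      simp [average, agentCoord_apply]
    rw [he]
    refine h2.trans (mul_le_mul_of_nonneg_left (add_le_add ?_ ?_) hc.le)
    · exact mul_le_mul_of_nonneg_left (norm_agentCoord_le k _) (Real.rpow_nonneg h0.le _)
    · refine intervalIntegral.integral_mono_on ht (intervalIntegrable_rpow_mul_norm hint h0 ht)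
        (intervalIntegrable_rpow_mul_norm h.1 h0 ht) fun s _ => ?_
      exact mul_le_mul_of_nonneg_left (norm_agentCoord_le k _) (Real.rpow_nonneg h0.le _)
  have hnorm : ‖x t i - w t i • average (x t)‖ ≤ (d + 1) * c * R := by
    refine (norm_le_sum_abs _).trans ((Finset.sum_le_sum fun k _ => hcoord k).trans ?_)
    simp only [Finset.sum_const, Finset.card_univ, Fintype.card_fin, nsmul_eq_mul]
    nlinarith [mul_nonneg hc.le hR0]
  have hout : (pushSum d L).out t (x t) (w t) i - average (x t)
      = (w t i)⁻¹ • (x t i - w t i • average (x t)) := by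
    rw [smul_sub, inv_smul_smul₀ hwpos.ne']
    rfl
  rw [hout, norm_smul, norm_inv, Real.norm_eq_abs, abs_of_pos hwpos, mul_assoc p⁻¹]
  exact mul_le_mul (inv_anti₀ hp hwi) hnorm (norm_nonneg _) (by positivity)

end

/-! ### Lyapunov estimates -/

theorem exists_tendsto_of_antitoneOn {g : ℝ → ℝ} {m : ℝ} (hg : AntitoneOn g (Ici 0))
    (hm : ∀ t, 0 ≤ t → m ≤ g t) : ∃ l, Tendsto g atTop (𝓝 l) := by
  have hanti : Antitone fun t => g (max t 0) := fun s t hst =>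
    hg (mem_Ici.2 (le_max_right _ _)) (mem_Ici.2 (le_max_right _ _)) (max_le_max_right 0 hst)
  have hbdd : BddBelow (range fun t => g (max t 0)) :=
    ⟨m, by rintro _ ⟨t, rfl⟩; exact hm _ (le_max_right _ _)⟩
  refine ⟨_, (tendsto_atTop_ciInf hanti hbdd).congr' ?_⟩
  filter_upwards [eventually_ge_atTop 0] with t ht
  rw [max_eq_left ht]

/-- If `q ≥ ε` from some time on, then `G + ε ∫ β` is eventually nonincreasing; as `G` is bounded
below, `∫ β` would be bounded. -/
theorem frequently_lt_of_ae_deriv_le {G β q : ℝ → ℝ} {m : ℝ}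
    (hG : ∀ T, 0 ≤ T → AbsolutelyContinuousOnInterval G 0 T) (hm : ∀ t, 0 ≤ t → m ≤ G t)
    (hβ : LocallyIntegrableOn β (Ici 0)) (hβ0 : ∀ t, 0 ≤ t → 0 ≤ β t)
    (hβi : ¬ ∃ I, ∀ t, 0 ≤ t → ∫ s in (0 : ℝ)..t, β s ≤ I)
    (hd : ∀ᵐ t : ℝ, 0 < t → ∃ G', HasDerivAt G G' t ∧ G' ≤ -(β t * q t)) {ε : ℝ} (hε : 0 < ε) :
    ∃ᶠ t in atTop, q t < ε := by
  intro hev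
  obtain ⟨T₁, hT₁⟩ := eventually_atTop.1 hev
  set T₀ := max T₁ 0 with hT₀
  have hT0 : 0 ≤ T₀ := le_max_right _ _
  set I : ℝ → ℝ := fun t => ∫ s in (0 : ℝ)..t, β s with hI
  have hanti : AntitoneOn (fun t => G t + ε * I t) (Ici T₀) := by
    refine antitoneOn_of_ae_deriv_nonpos (fun T hT => ?_) ?_
    · refine AbsolutelyContinuousOnInterval.mono
        ((hG T (hT0.trans hT)).fun_add
          ((absolutelyContinuous_primitive hβ (hT0.trans hT)).const_mul ε)) ?_
      rw [uIcc_of_le hT, uIcc_of_le (hT0.trans hT)]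
      exact Icc_subset_Icc_left hT0
    · filter_upwards [hd, ae_hasDerivAt_primitive hβ] with t h1 h2 ht
      have ht0 : 0 < t := lt_of_le_of_lt hT0 ht
      obtain ⟨G', h3, h4⟩ := h1 ht0
      refine ⟨_, h3.add ((h2 ht0).const_mul ε), ?_⟩
      have h5 : ε ≤ q t := not_lt.1 (hT₁ t ((le_max_left _ _).trans ht.le))
      nlinarith [mul_le_mul_of_nonneg_left h5 (hβ0 t ht0.le)]
  have hmono : ∀ s t, 0 ≤ s → s ≤ t → I s ≤ I t := fun s t hs hst => by
    have h := intervalIntegral.integral_add_adjacent_intervals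
      (intervalIntegrable_of_locallyIntegrableOn hβ le_rfl hs)
      (intervalIntegrable_of_locallyIntegrableOn hβ hs (hs.trans hst))
    have h' : 0 ≤ ∫ r in s..t, β r :=
      intervalIntegral.integral_nonneg hst fun r hr => hβ0 r (hs.trans hr.1)
    simp only [hI]
    linarith
  refine hβi ⟨(G T₀ + ε * I T₀ - m) / ε, fun t ht => ?_⟩
  have h1 := hanti (mem_Ici.2 le_rfl) (mem_Ici.2 (le_max_right t T₀)) (le_max_right t T₀)
  have h2 := hm (max t T₀) (ht.trans (le_max_left _ _))
  have h3 := hmono t (max t T₀) ht (le_max_left _ _)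
  rw [le_div_iff₀ hε]
  simp only at h1
  change I t * ε ≤ _
  nlinarith

theorem StepSizeAssumption.locallyIntegrableOn {α : ℝ → ℝ} (hα : StepSizeAssumption α) :
    LocallyIntegrableOn α (Ici 0) := by
  -- Domination `|α| ≤ 1 + α²`.
  have h1 : LocallyIntegrableOn (fun t => 1 + α t ^ 2) (Ici 0) :=
    ((continuous_const.locallyIntegrable).locallyIntegrableOn _).add
      hα.sq_integrable.locallyIntegrableOn
  intro t ht
  obtain ⟨U, hU, h⟩ := h1 t ht
  refine ⟨U ∩ Ici 0, inter_mem hU self_mem_nhdsWithin, ?_⟩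
  refine Integrable.mono' (h.mono_set inter_subset_left)
    (hα.measurable.aestronglyMeasurable.mono_set inter_subset_right)
    (Eventually.of_forall fun s => ?_)
  rw [Real.norm_eq_abs]
  rcases abs_cases (α s) with h | h <;> nlinarith [sq_nonneg (α s - 1), sq_nonneg (α s + 1)]

theorem StepSizeAssumption.not_bounded {α : ℝ → ℝ} (hα : StepSizeAssumption α) :
    ¬ ∃ I, ∀ t, 0 ≤ t → ∫ s in (0 : ℝ)..t, α s ≤ I := by
  rintro ⟨I, hI⟩
  have hint : IntegrableOn α (Ioi 0) := by
    refine integrableOn_Ioi_of_intervalIntegral_norm_bounded (l := atTop) (b := id) I 0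
      (fun t => ?_) tendsto_id ?_
    · exact (hα.locallyIntegrableOn.integrableOn_compact_subset Icc_subset_Ici_self
        isCompact_Icc).mono_set Ioc_subset_Icc_self
    · filter_upwards [eventually_ge_atTop 0] with t ht
      refine le_trans (le_of_eq ?_) (hI t ht)
      refine intervalIntegral.integral_congr fun s hs => ?_
      rw [uIcc_of_le (by simpa using ht)] at hs
      exact Real.norm_of_nonneg (hα.nonneg s hs.1)
  have h := (IntegrableOn.integrable (integrableOn_Ici_iff_integrableOn_Ioi (by simp) |>.2 hint)).lintegral_lt_top
  exact h.ne hα.integral_eq_top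

theorem absolutelyContinuous_exp_comp {f : ℝ → ℝ} {a b : ℝ}
    (hf : AbsolutelyContinuousOnInterval f a b) :
    AbsolutelyContinuousOnInterval (fun t => Real.exp (f t)) a b := by
  have h : LocallyLipschitz Real.exp := Real.contDiff_exp.locallyLipschitz (𝕂 := ℝ)
  exact absolutelyContinuous_comp_locallyLipschitz hf h

/-- Young's inequality for the cross terms of the Lyapunov function. -/
theorem cross_term_le {a e r B μ : ℝ} (hμ : 0 < μ) :
    5 * (B * a * e * (1 + r + e)) ≤
      μ * (e * e) + 75 * B ^ 2 / μ * (a ^ 2 * (1 + r ^ 2 + 2 * (e * e))) := by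
  have h1 : (1 + r + e) ^ 2 ≤ 3 * (1 + r ^ 2 + 2 * (e * e)) := by
    nlinarith [sq_nonneg (1 - r), sq_nonneg (1 - e), sq_nonneg (r - e), sq_nonneg e]
  have h2 : 25 * B ^ 2 / μ * (a ^ 2 * (1 + r + e) ^ 2) ≤
      75 * B ^ 2 / μ * (a ^ 2 * (1 + r ^ 2 + 2 * (e * e))) := by
    have : 75 * B ^ 2 / μ * (a ^ 2 * (1 + r ^ 2 + 2 * (e * e)))
        = 25 * B ^ 2 / μ * (a ^ 2 * (3 * (1 + r ^ 2 + 2 * (e * e)))) := by ring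
    rw [this]
    gcongr
  refine le_trans ?_ (add_le_add_right h2 _)
  have h3 : μ * (μ * (e * e) + 25 * B ^ 2 / μ * (a ^ 2 * (1 + r + e) ^ 2))
      = (μ * e) ^ 2 + (5 * B * a * (1 + r + e)) ^ 2 := by
    field_simp
    ring
  refine le_of_mul_le_mul_left ?_ hμ
  rw [h3]
  nlinarith [sq_nonneg (μ * e - 5 * B * a * (1 + r + e)), sq_nonneg (μ * e),
    sq_nonneg (5 * B * a * (1 + r + e))]

/-- Convergence of a perturbed Lyapunov function `N²`, the perturbation `E` being driven by the
step size. -/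
theorem lyapunov_convergence {α N E Δ : ℝ → ℝ} {κ μ B : ℝ} (hα : StepSizeAssumption α)
    (hκ : 0 < κ) (hμ : 0 < μ) (hB : 0 ≤ B)
    (hN : ∀ T, 0 ≤ T → AbsolutelyContinuousOnInterval (fun t => N t ^ 2) 0 T)
    (hE : ∀ T, 0 ≤ T → AbsolutelyContinuousOnInterval E 0 T)
    (hN0 : ∀ t, 0 ≤ t → 0 ≤ N t) (hE0 : ∀ t, 0 ≤ t → 0 ≤ E t) (hΔ0 : ∀ t, 0 ≤ t → 0 ≤ Δ t)
    (hNd : ∀ᵐ t : ℝ, 0 < t → ∃ N', HasDerivAt (fun t => N t ^ 2) N' t ∧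
      N' ≤ -(κ * (α t * Δ t)) + B * α t * E t * (1 + N t + E t))
    (hEd : ∀ᵐ t : ℝ, 0 < t → ∃ E', HasDerivAt E E' t ∧
      E' ≤ -(μ * E t) + B * α t * (1 + N t + E t)) :
    (∃ l, Tendsto (fun t => N t ^ 2) atTop (𝓝 l)) ∧ Tendsto E atTop (𝓝 0) ∧
      ∀ ε, 0 < ε → ∃ᶠ t in atTop, Δ t < ε := by
  set M : ℝ := 75 * B ^ 2 / μ with hM
  have hM0 : 0 ≤ M := by positivity
  set A : ℝ → ℝ := fun t => ∫ s in (0 : ℝ)..t, α s ^ 2 with hA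
  have hsq : LocallyIntegrableOn (fun t => α t ^ 2) (Ici 0) :=
    hα.sq_integrable.locallyIntegrableOn
  have hAac : ∀ T, 0 ≤ T → AbsolutelyContinuousOnInterval A 0 T := fun T hT =>
    absolutelyContinuous_primitive hsq hT
  have hAd := ae_hasDerivAt_primitive hsq
  set A₁ : ℝ := ∫ s in Ioi (0 : ℝ), α s ^ 2 with hA₁
  have hAle : ∀ t, 0 ≤ t → A t ≤ A₁ := fun t ht => by
    simp only [hA, hA₁, intervalIntegral.integral_of_le ht]
    exact setIntegral_mono_set (hα.sq_integrable.mono_set Ioi_subset_Ici_self)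
      (Eventually.of_forall fun s => sq_nonneg _) (Eventually.of_forall Ioc_subset_Ioi_self)
  have hAlim : Tendsto A atTop (𝓝 A₁) :=
    intervalIntegral_tendsto_integral_Ioi 0 (hα.sq_integrable.mono_set Ioi_subset_Ici_self)
      tendsto_id
  -- Write `X = B α E (1 + N + E)`. It enters `U'` once through `N²` and four times through `2 E²`,
  -- whence the `5` in Young's inequality; the `μ E²` it costs is absorbed by the damping `4 μ E²`.
  -- The summand `1` lets `U` dominate `(1 + N + E)²` up to a factor `3`.
  set U : ℝ → ℝ := fun t => 1 + N t ^ 2 + 2 * (E t * E t) with hU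
  have hEE : ∀ T, 0 ≤ T → AbsolutelyContinuousOnInterval (fun t => E t * E t) 0 T :=
    fun T hT => (hE T hT).fun_mul (hE T hT)
  have hUac : ∀ T, 0 ≤ T → AbsolutelyContinuousOnInterval U 0 T := fun T hT =>
    ((absolutelyContinuous_const 1 0 T).fun_add (hN T hT)).fun_add ((hEE T hT).const_mul 2)
  have hU1 : ∀ t, 1 ≤ U t := fun t => by
    simp only [hU]
    nlinarith [sq_nonneg (N t), mul_self_nonneg (E t)]
  have hyoung : ∀ t, 5 * (B * α t * E t * (1 + N t + E t)) ≤
      μ * (E t * E t) + M * (α t ^ 2 * U t) := fun t => cross_term_le hμ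
  have hEEd : ∀ᵐ t : ℝ, 0 < t → ∃ D, HasDerivAt (fun t => E t * E t) D t ∧
      D ≤ -(2 * μ * (E t * E t)) + 2 * (B * α t * E t * (1 + N t + E t)) := by
    filter_upwards [hEd] with t h1 h0
    obtain ⟨E', h2, h3⟩ := h1 h0
    refine ⟨_, h2.mul h2, ?_⟩
    nlinarith [mul_le_mul_of_nonneg_left h3 (hE0 t h0.le)]
  have hcross : ∀ t, 0 ≤ t → 0 ≤ B * α t * E t * (1 + N t + E t) := fun t ht => by
    have := hα.nonneg t ht
    have := hE0 t ht
    have := hN0 t ht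
    positivity
  have hUd : ∀ᵐ t : ℝ, 0 < t → ∃ D, HasDerivAt U D t ∧
      D ≤ -(κ * (α t * Δ t)) + M * (α t ^ 2 * U t) := by
    filter_upwards [hNd, hEEd] with t h1 h2 h0
    obtain ⟨N', h3, h4⟩ := h1 h0
    obtain ⟨D, h5, h6⟩ := h2 h0
    refine ⟨_, (h3.const_add 1).add (h5.const_mul 2), ?_⟩
    have := hyoung t
    have := mul_nonneg hμ.le (mul_self_nonneg (E t))
    linarith
  -- Integrating factor for the growth term `M α² U`; it stays between positive constants because `∫
  -- α²` is finite.
  set Z : ℝ → ℝ := fun t => U t * Real.exp (-M * A t) with hZ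
  have hexp : ∀ T, 0 ≤ T → AbsolutelyContinuousOnInterval (fun t => Real.exp (-M * A t)) 0 T :=
    fun T hT => absolutelyContinuous_exp_comp ((hAac T hT).const_mul (-M))
  have hZac : ∀ T, 0 ≤ T → AbsolutelyContinuousOnInterval Z 0 T := fun T hT =>
    (hUac T hT).fun_mul (hexp T hT)
  have hZ0 : ∀ t, 0 ≤ t → 0 ≤ Z t := fun t _ =>
    mul_nonneg (zero_le_one.trans (hU1 t)) (Real.exp_pos _).le
  have hZd : ∀ᵐ t : ℝ, 0 < t → ∃ D, HasDerivAt Z D t ∧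
      D ≤ -(α t * (κ * Real.exp (-M * A₁) * Δ t)) := by
    filter_upwards [hUd, hAd] with t h1 h2 h0
    obtain ⟨D, h3, h4⟩ := h1 h0
    refine ⟨_, h3.mul (((h2 h0).const_mul (-M)).exp), ?_⟩
    have h5 : Real.exp (-M * A₁) ≤ Real.exp (-M * A t) :=
      Real.exp_le_exp.2 (by nlinarith [hAle t h0.le])
    have h6 : 0 ≤ κ * (α t * Δ t) :=
      mul_nonneg hκ.le (mul_nonneg (hα.nonneg t h0.le) (hΔ0 t h0.le))
    have h7 := mul_le_mul_of_nonneg_right h4 (Real.exp_pos (-M * A t)).le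
    have h8 := mul_le_mul_of_nonneg_left h5 h6
    change D * Real.exp (-M * A t) + U t * (Real.exp (-M * A t) * (-M * α t ^ 2)) ≤ _
    linarith
  have hZanti : AntitoneOn Z (Ici 0) := by
    refine antitoneOn_of_ae_deriv_nonpos hZac ?_
    filter_upwards [hZd] with t h1 h0
    obtain ⟨D, h2, h3⟩ := h1 h0
    refine ⟨D, h2, h3.trans ?_⟩
    have := hα.nonneg t h0.le
    have := hΔ0 t h0.le
    have : 0 ≤ α t * (κ * Real.exp (-M * A₁) * Δ t) := by positivity
    linarith
  obtain ⟨z, hz⟩ := exists_tendsto_of_antitoneOn hZanti hZ0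
  have hUlim : Tendsto U atTop (𝓝 (z * Real.exp (M * A₁))) := by
    have h1 : Tendsto (fun t => Real.exp (M * A t)) atTop (𝓝 (Real.exp (M * A₁))) :=
      (Real.continuous_exp.tendsto _).comp (hAlim.const_mul M)
    refine (hz.mul h1).congr fun t => ?_
    simp only [hZ]
    rw [mul_assoc, ← Real.exp_add]
    simp
  have hUbd : ∀ t, 0 ≤ t → U t ≤ Z 0 * Real.exp (M * A₁) := fun t ht => by
    have h1 : Z t ≤ Z 0 := hZanti (mem_Ici.2 le_rfl) (mem_Ici.2 ht) ht
    have h2 : U t = Z t * Real.exp (M * A t) := by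
      simp only [hZ]
      rw [mul_assoc, ← Real.exp_add]
      simp
    rw [h2]
    refine mul_le_mul h1 (Real.exp_le_exp.2 ?_) (Real.exp_pos _).le (hZ0 0 le_rfl)
    exact mul_le_mul_of_nonneg_left (hAle t ht) hM0
  set M₂ : ℝ := M * (Z 0 * Real.exp (M * A₁)) with hM₂
  have hM₂0 : 0 ≤ M₂ := mul_nonneg hM0 (mul_nonneg (hZ0 0 le_rfl) (Real.exp_pos _).le)
  -- With `U` now bounded, the forcing of `E²` is at most `M₂ α²`, and subtracting its primitive
  -- leaves a function with derivative at most `-μ E²`. So `E²` converges, and its limit is `0`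
  -- because `E²` is small at arbitrarily late times.
  set G : ℝ → ℝ := fun t => E t * E t - M₂ * A t with hG
  have hGac : ∀ T, 0 ≤ T → AbsolutelyContinuousOnInterval G 0 T := fun T hT =>
    (hEE T hT).fun_sub ((hAac T hT).const_mul M₂)
  have hGm : ∀ t, 0 ≤ t → -(M₂ * A₁) ≤ G t := fun t ht => by
    have := mul_le_mul_of_nonneg_left (hAle t ht) hM₂0
    have := mul_self_nonneg (E t)
    simp only [hG]
    linarith
  have hGd : ∀ᵐ t : ℝ, 0 < t → ∃ D, HasDerivAt G D t ∧ D ≤ -(1 * (μ * (E t * E t))) := by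
    filter_upwards [hEEd, hAd] with t h1 h2 h0
    obtain ⟨D, h3, h4⟩ := h1 h0
    refine ⟨_, h3.sub ((h2 h0).const_mul M₂), ?_⟩
    have h5 := hyoung t
    have h6 := hcross t h0.le
    have h7 : M * (α t ^ 2 * U t) ≤ M₂ * α t ^ 2 := by
      rw [hM₂]
      nlinarith [mul_le_mul_of_nonneg_left (hUbd t h0.le)
        (mul_nonneg hM0 (sq_nonneg (α t)))]
    linarith
  have hGanti : AntitoneOn G (Ici 0) := by
    refine antitoneOn_of_ae_deriv_nonpos hGac ?_
    filter_upwards [hGd] with t h1 h0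
    obtain ⟨D, h2, h3⟩ := h1 h0
    refine ⟨D, h2, h3.trans ?_⟩
    have := mul_nonneg hμ.le (mul_self_nonneg (E t))
    linarith
  obtain ⟨g, hg⟩ := exists_tendsto_of_antitoneOn hGanti hGm
  have hEElim : Tendsto (fun t => E t * E t) atTop (𝓝 (g + M₂ * A₁)) := by
    refine (hg.add (hAlim.const_mul M₂)).congr fun t => ?_
    simp only [hG]
    ring
  have hfreqE : ∀ ε, 0 < ε → ∃ᶠ t in atTop, μ * (E t * E t) < ε := fun ε hε => by
    refine frequently_lt_of_ae_deriv_le (β := fun _ => 1) hGac hGm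
      ((continuous_const.locallyIntegrable).locallyIntegrableOn _) (fun _ _ => zero_le_one)
      ?_ hGd hε
    rintro ⟨I, hI⟩
    have := hI (|I| + 1) (by positivity)
    simp only [intervalIntegral.integral_const, smul_eq_mul, sub_zero, mul_one] at this
    linarith [le_abs_self I]
  have hlim0 : g + M₂ * A₁ = 0 := by
    by_contra hne
    have hnn : 0 ≤ g + M₂ * A₁ :=
      ge_of_tendsto hEElim (Eventually.of_forall fun t => mul_self_nonneg (E t))
    have hpos : 0 < g + M₂ * A₁ := lt_of_le_of_ne hnn (Ne.symm hne)
    have hev := hEElim.eventually (lt_mem_nhds (half_lt_self hpos))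
    obtain ⟨t, h1, h2⟩ := ((hfreqE _ (mul_pos hμ (half_pos hpos))).and_eventually hev).exists
    exact absurd (lt_of_mul_lt_mul_left h1 hμ.le) (not_lt.2 h2.le)
  rw [hlim0] at hEElim
  refine ⟨⟨z * Real.exp (M * A₁) - 1 - 2 * 0, ?_⟩, ?_, fun ε hε => ?_⟩
  · refine ((hUlim.sub_const 1).sub (hEElim.const_mul 2)).congr fun t => ?_
    simp only [hU]
    ring
  · have h1 := (Real.continuous_sqrt.tendsto 0).comp hEElim
    rw [Real.sqrt_zero] at h1
    refine h1.congr' ?_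
    filter_upwards [eventually_ge_atTop 0] with t ht
    exact Real.sqrt_mul_self (hE0 t ht)
  · have hc : 0 < κ * Real.exp (-M * A₁) := mul_pos hκ (Real.exp_pos _)
    refine (frequently_lt_of_ae_deriv_le hZac hZ0 hα.locallyIntegrableOn hα.nonneg
      hα.not_bounded hZd (mul_pos hc hε)).mono fun t ht => ?_
    exact lt_of_mul_lt_mul_left ht hc.le

/-! ### Subgradients -/

section

variable {n d : ℕ}

theorem convexOn_continuous {f : EuclideanSpace ℝ (Fin d) → ℝ} (hf : ConvexOn ℝ univ f) :
    Continuous f :=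
  hf.locallyLipschitz.continuous

/-- A hyperplane separates `(x, f x)` from the open strict epigraph. Testing with `(x, f x + 1)`
shows that its vertical coefficient `c` is negative, so it is the graph of an affine minorant
touching at `x`. -/
theorem subdifferential_nonempty {f : EuclideanSpace ℝ (Fin d) → ℝ} (hf : ConvexOn ℝ univ f)
    (x : EuclideanSpace ℝ (Fin d)) : (subdifferential f x).Nonempty := by
  have hcont := convexOn_continuous hf
  set S : Set (EuclideanSpace ℝ (Fin d) × ℝ) := {p | p.1 ∈ univ ∧ f p.1 < p.2} with hS
  have hSo : IsOpen S := by
    have : S = {p | f p.1 < p.2} := by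
      ext p
      simp [hS]
    rw [this]
    exact isOpen_lt (hcont.comp continuous_fst) continuous_snd
  have hx : (x, f x) ∉ S := fun h => lt_irrefl _ h.2
  obtain ⟨φ, hφ⟩ := geometric_hahn_banach_open_point hf.convex_strict_epigraph hSo hx
  set c : ℝ := φ (0, 1) with hc
  set ψ : EuclideanSpace ℝ (Fin d) →L[ℝ] ℝ :=
    φ.comp (ContinuousLinearMap.inl ℝ (EuclideanSpace ℝ (Fin d)) ℝ) with hψ
  have hdec : ∀ z r, φ (z, r) = ψ z + r * c := by
    intro z r
    have : ((z, r) : EuclideanSpace ℝ (Fin d) × ℝ) = (z, 0) + r • (0, 1) := by simp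
    rw [this, map_add, map_smul]
    rfl
  have hlt : ∀ z r, f z < r → ψ z + r * c < ψ x + f x * c := by
    intro z r h
    rw [← hdec, ← hdec]
    exact hφ (z, r) ⟨mem_univ z, h⟩
  have hc0 : c < 0 := by
    have := hlt x (f x + 1) (by linarith)
    linarith
  have hle : ∀ z, ψ z + f z * c ≤ ψ x + f x * c := by
    intro z
    have hlim : Tendsto (fun ε : ℝ => ψ z + (f z + ε) * c) (𝓝[>] 0) (𝓝 (ψ z + (f z + 0) * c)) :=
      ((by fun_prop : Continuous fun ε : ℝ => ψ z + (f z + ε) * c).tendsto 0).mono_left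
        nhdsWithin_le_nhds
    rw [add_zero] at hlim
    refine le_of_tendsto hlim ?_
    filter_upwards [self_mem_nhdsWithin] with ε hε
    exact (hlt z _ (lt_add_of_pos_right _ hε)).le
  refine ⟨(-c)⁻¹ • (InnerProductSpace.toDual ℝ _).symm ψ, fun z => ?_⟩
  rw [real_inner_smul_left, InnerProductSpace.toDual_symm_apply, map_sub]
  have h := hle z
  have h2 : (-c)⁻¹ * (ψ z - ψ x) ≤ f z - f x := by
    rw [inv_mul_le_iff₀ (by linarith)]
    linarith
  linarith

/-! ### Convergence of the distributed optimization dynamics -/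

theorem OptimizationAssumption.exists_growth {f : Fin n → EuclideanSpace ℝ (Fin d) → ℝ}
    (hf : OptimizationAssumption f) (xs : EuclideanSpace ℝ (Fin d)) :
    ∃ K : ℝ, 0 ≤ K ∧ ∀ i x, ∀ g ∈ subdifferential (f i) x, ‖g‖ ≤ K * (1 + ‖x - xs‖) := by
  obtain ⟨K, hK⟩ := hf.growth
  refine ⟨|K| * (1 + ‖xs‖), by positivity, fun i x g hg => (hK i x g hg).trans ?_⟩
  have h1 : ‖x‖ ≤ ‖x - xs‖ + ‖xs‖ := by simpa using norm_add_le (x - xs) xs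
  have h2 : K * (1 + ‖x‖) ≤ |K| * (1 + ‖x‖) :=
    mul_le_mul_of_nonneg_right (le_abs_self K) (by positivity)
  have h3 : 1 + ‖x‖ ≤ (1 + ‖xs‖) * (1 + ‖x - xs‖) := by
    nlinarith [mul_nonneg (norm_nonneg xs) (norm_nonneg (x - xs))]
  have h4 := mul_le_mul_of_nonneg_left h3 (abs_nonneg K)
  linarith

/-- The descent inequality for one agent: a subgradient at a point within `e` of `z`. -/
theorem subgradient_descent {φ : EuclideanSpace ℝ (Fin d) → ℝ} (hφ : ConvexOn ℝ univ φ)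
    {xs y z g : EuclideanSpace ℝ (Fin d)} {K e : ℝ} (hK0 : 0 ≤ K)
    (hK : ∀ x, ∀ g ∈ subdifferential φ x, ‖g‖ ≤ K * (1 + ‖x - xs‖))
    (hg : g ∈ subdifferential φ y) (he : ‖y - z‖ ≤ e) :
    ‖g‖ ≤ K * (1 + ‖z - xs‖ + e) ∧
      -inner ℝ (z - xs) g ≤ -(φ z - φ xs) + 2 * K * e * (1 + ‖z - xs‖ + e) := by
  have he0 : 0 ≤ e := (norm_nonneg _).trans he
  have hy : ‖y - xs‖ ≤ ‖z - xs‖ + e := by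
    have := norm_add_le (z - xs) (y - z)
    rw [show z - xs + (y - z) = y - xs by abel] at this
    linarith
  have hgn : ‖g‖ ≤ K * (1 + ‖z - xs‖ + e) :=
    (hK y g hg).trans (mul_le_mul_of_nonneg_left (by linarith) hK0)
  refine ⟨hgn, ?_⟩
  -- The subgradient `g` lives at `y`, but the decrease is wanted at `z`. A subgradient `h` at `z`
  -- bounds `φ z - φ y`; `g` and `h` each contribute one error term `K e (1 + ‖z - xs‖ + e)`.
  obtain ⟨h, hh⟩ := subdifferential_nonempty hφ z
  have hhn : ‖h‖ ≤ K * (1 + ‖z - xs‖ + e) :=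
    (hK z h hh).trans (mul_le_mul_of_nonneg_left (by linarith) hK0)
  have h1 := hg xs
  have h2 := hh y
  have h3 : -(‖h‖ * e) ≤ inner ℝ h (y - z) := by
    have := neg_le_of_abs_le (abs_real_inner_le_norm h (y - z))
    have := mul_le_mul_of_nonneg_left he (norm_nonneg h)
    linarith
  have h4 : inner ℝ g (y - z) ≤ ‖g‖ * e :=
    (real_inner_le_norm g (y - z)).trans (mul_le_mul_of_nonneg_left he (norm_nonneg g))
  have h5 : inner ℝ (z - xs) g = -inner ℝ g (xs - y) - inner ℝ g (y - z) := by
    rw [real_inner_comm, ← inner_neg_right, ← inner_sub_right]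
    congr 1
    abel
  have h6 := mul_le_mul_of_nonneg_right hgn he0
  have h7 := mul_le_mul_of_nonneg_right hhn he0
  rw [h5]
  linarith

theorem absolutelyContinuous_norm_sub_sq {E : Type*} [NormedAddCommGroup E]
    [InnerProductSpace ℝ E] {z : ℝ → E} {a b : ℝ} (hz : AbsolutelyContinuousOnInterval z a b)
    (c : E) : AbsolutelyContinuousOnInterval (fun t => ‖z t - c‖ ^ 2) a b := by
  have hC : ContDiff ℝ 1 fun v : E => ‖v - c‖ ^ 2 :=
    (contDiff_id.sub contDiff_const).norm_sq ℝ
  have h : LocallyLipschitz fun v : E => ‖v - c‖ ^ 2 := hC.locallyLipschitz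
  exact absolutelyContinuous_comp_locallyLipschitz (φ := fun v : E => ‖v - c‖ ^ 2) hz h

/-- The perturbed averaged dynamics approach each minimizer in the sense of Fejér, and come
arbitrarily close to optimality. -/
theorem averaged_dynamics_fejer (hn : 0 < n) {f : Fin n → EuclideanSpace ℝ (Fin d) → ℝ}
    (hf : OptimizationAssumption f) {α : ℝ → ℝ} (hα : StepSizeAssumption α)
    {u y : ℝ → AgentVec n d} {z : ℝ → EuclideanSpace ℝ (Fin d)} {E : ℝ → ℝ} {c μ : ℝ}
    (hc : 0 ≤ c) (hμ : 0 < μ)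
    (hz : IsCaratheodorySolution (fun t _ => average (u t)) 0 z)
    (hE : IsCaratheodorySolution (fun t e => -(μ * e) + c * ‖u t‖) 0 E)
    (hyz : ∀ t, 0 ≤ t → ∀ i, ‖y t i - z t‖ ≤ E t) (hu : IsGradientFeedback f α u y)
    {xs : EuclideanSpace ℝ (Fin d)} (hxs : xs ∈ optimalSet f) :
    (∃ l, Tendsto (fun t => ‖z t - xs‖ ^ 2) atTop (𝓝 l)) ∧ Tendsto E atTop (𝓝 0) ∧
      ∀ ε, 0 < ε → ∃ᶠ t in atTop, ∑ i, f i (z t) - ∑ i, f i xs < ε := by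
  obtain ⟨K, hK0, hK⟩ := hf.exists_growth xs
  have hn' : (0 : ℝ) < n := by exact_mod_cast hn
  have hE0 : ∀ t, 0 ≤ t → 0 ≤ E t := fun t ht => (norm_nonneg _).trans (hyz t ht ⟨0, hn⟩)
  -- The derivative of the squared norm doubles both the averaged decrease `α Δ / n` and the error
  -- `2 K`. The term `c K` comes from the input in the equation for `E`; a single `B` serves both
  -- inequalities.
  refine lyapunov_convergence (κ := 2 / n) (μ := μ) (B := 4 * K + c * K)
    (N := fun t => ‖z t - xs‖) hα (by positivity) hμ (by positivity)
    (fun T hT => absolutelyContinuous_norm_sub_sq (hz.1 T hT) xs) hE.1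
    (fun t _ => norm_nonneg _) hE0 (fun t _ => sub_nonneg.2 (hxs _)) ?_ ?_
  · filter_upwards [hz.2, hu] with t h1 h2 h0
    refine ⟨_, ((h1 h0).sub_const xs).norm_sq, ?_⟩
    have hα0 := hα.nonneg t h0.le
    have hφ0 : 0 ≤ 1 + ‖z t - xs‖ + E t := by
      have := hE0 t h0.le
      positivity
    have hi : ∀ i, inner ℝ (z t - xs) (u t i) ≤
        α t * (-(f i (z t) - f i xs) + 2 * K * E t * (1 + ‖z t - xs‖ + E t)) := by
      intro i
      obtain ⟨g, hg, hug⟩ := h2 h0.le i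
      rw [hug, inner_neg_right, real_inner_smul_right, ← mul_neg]
      exact mul_le_mul_of_nonneg_left
        (subgradient_descent (hf.convex i) hK0 (hK i) hg (hyz t h0.le i)).2 hα0
    have hsum : inner ℝ (z t - xs) (average (u t)) ≤
        (n : ℝ)⁻¹ * (α t * (-(∑ i, f i (z t) - ∑ i, f i xs)
          + n * (2 * K * E t * (1 + ‖z t - xs‖ + E t)))) := by
      rw [average, real_inner_smul_right, inner_sum]
      refine mul_le_mul_of_nonneg_left ((Finset.sum_le_sum fun i _ => hi i).trans (le_of_eq ?_))
        (by positivity)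
      rw [← Finset.mul_sum, Finset.sum_add_distrib, Finset.sum_neg_distrib,
        Finset.sum_sub_distrib]
      simp
    have hsum' : (n : ℝ)⁻¹ * (α t * (-(∑ i, f i (z t) - ∑ i, f i xs)
          + n * (2 * K * E t * (1 + ‖z t - xs‖ + E t))))
        = -((n : ℝ)⁻¹ * (α t * (∑ i, f i (z t) - ∑ i, f i xs)))
          + 2 * K * α t * E t * (1 + ‖z t - xs‖ + E t) := by
      field_simp
    have hextra : 0 ≤ c * K * α t * E t * (1 + ‖z t - xs‖ + E t) := by
      have := hE0 t h0.le
      positivity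
    rw [hsum'] at hsum
    rw [div_eq_mul_inv]
    linarith
  · filter_upwards [hE.2, hu] with t h1 h2 h0
    refine ⟨_, h1 h0, ?_⟩
    have hα0 := hα.nonneg t h0.le
    have hφ0 : 0 ≤ 1 + ‖z t - xs‖ + E t := by
      have := hE0 t h0.le
      positivity
    have hun : ‖u t‖ ≤ α t * (K * (1 + ‖z t - xs‖ + E t)) := by
      refine (pi_norm_le_iff_of_nonneg (by positivity)).2 fun i => ?_
      obtain ⟨g, hg, hug⟩ := h2 h0.le i
      rw [hug, norm_neg, norm_smul, Real.norm_of_nonneg hα0]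
      exact mul_le_mul_of_nonneg_left
        (subgradient_descent (hf.convex i) hK0 (hK i) hg (hyz t h0.le i)).1 hα0
    have h3 := mul_le_mul_of_nonneg_left hun hc
    have h4 : 0 ≤ 4 * K * α t * (1 + ‖z t - xs‖ + E t) := by positivity
    linarith

/-- Opial's argument: convergence of the distance to every minimizer, together with one optimal
cluster point, forces convergence to that point. -/
theorem averaged_dynamics_converges (hn : 0 < n) {f : Fin n → EuclideanSpace ℝ (Fin d) → ℝ}
    (hf : OptimizationAssumption f) {α : ℝ → ℝ} (hα : StepSizeAssumption α)
    {u y : ℝ → AgentVec n d} {z : ℝ → EuclideanSpace ℝ (Fin d)} {E : ℝ → ℝ} {c μ : ℝ}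
    (hc : 0 ≤ c) (hμ : 0 < μ)
    (hz : IsCaratheodorySolution (fun t _ => average (u t)) 0 z)
    (hE : IsCaratheodorySolution (fun t e => -(μ * e) + c * ‖u t‖) 0 E)
    (hyz : ∀ t, 0 ≤ t → ∀ i, ‖y t i - z t‖ ≤ E t) (hu : IsGradientFeedback f α u y) :
    ∃ xs ∈ optimalSet f, ∀ i, Tendsto (fun t => y t i) atTop (𝓝 xs) := by
  obtain ⟨x₀, hx₀⟩ := hf.nonempty
  have key := fun {xs} (hxs : xs ∈ optimalSet f) =>
    averaged_dynamics_fejer hn hf hα hc hμ hz hE hyz hu hxs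
  obtain ⟨⟨l, hl⟩, hE0, hfreq⟩ := key hx₀
  have hFc : Continuous fun x => ∑ i, f i x :=
    continuous_finsetSum _ fun i _ => convexOn_continuous (hf.convex i)
  obtain ⟨T, hT⟩ := eventually_atTop.1 (hl.eventually (gt_mem_nhds (lt_add_one l)))
  -- Times beyond `T` keep the sequence bounded, times beyond `k` make it diverge, and the gap `1 /
  -- (k + 1)` makes its cluster points optimal.
  have hpick : ∀ k : ℕ, ∃ t : ℝ, max T k ≤ t ∧
      ∑ i, f i (z t) - ∑ i, f i x₀ < 1 / ((k : ℝ) + 1) := fun k => by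
    obtain ⟨t, h1, h2⟩ := ((hfreq (1 / ((k : ℝ) + 1)) (by positivity)).and_eventually
      (eventually_ge_atTop (max T k))).exists
    exact ⟨t, h2, h1⟩
  choose τ hτ hτF using hpick
  have hτlim : Tendsto τ atTop atTop :=
    tendsto_atTop_mono (fun k => (le_max_right _ _).trans (hτ k)) tendsto_natCast_atTop_atTop
  have hbdd : ∀ k, z (τ k) ∈ Metric.closedBall x₀ (Real.sqrt (l + 1)) := fun k => by
    rw [Metric.mem_closedBall, dist_eq_norm]
    exact Real.le_sqrt_of_sq_le (hT _ ((le_max_left _ _).trans (hτ k))).le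
  obtain ⟨xs, -, σ, hσ, hlim⟩ := tendsto_subseq_of_bounded Metric.isBounded_closedBall hbdd
  have hτσ : Tendsto (fun k => τ (σ k)) atTop atTop := hτlim.comp hσ.tendsto_atTop
  have hxs : xs ∈ optimalSet f := by
    have h1 : Tendsto (fun k => ∑ i, f i (z (τ (σ k)))) atTop (𝓝 (∑ i, f i xs)) :=
      (hFc.tendsto xs).comp hlim
    have h2 : Tendsto (fun k => ∑ i, f i x₀ + 1 / ((σ k : ℝ) + 1)) atTop
        (𝓝 (∑ i, f i x₀ + 0)) :=
      tendsto_const_nhds.add (tendsto_one_div_add_atTop_nhds_zero_nat.comp hσ.tendsto_atTop)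
    rw [add_zero] at h2
    have h3 : ∑ i, f i xs ≤ ∑ i, f i x₀ := le_of_tendsto_of_tendsto' h1 h2 fun k => by
      linarith [hτF (σ k)]
    exact fun v => h3.trans (hx₀ v)
  refine ⟨xs, hxs, fun i => ?_⟩
  obtain ⟨⟨l', hl'⟩, -, -⟩ := key hxs
  have hsub : Tendsto (fun k => ‖z (τ (σ k)) - xs‖ ^ 2) atTop (𝓝 0) := by
    have h1 : Tendsto (fun k => ‖z (τ (σ k)) - xs‖) atTop (𝓝 0) :=
      tendsto_iff_norm_sub_tendsto_zero.1 hlim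
    simpa using h1.pow 2
  rw [tendsto_nhds_unique (hl'.comp hτσ) hsub] at hl'
  have hz0 : Tendsto (fun t => ‖z t - xs‖) atTop (𝓝 0) := by
    have h1 := (Real.continuous_sqrt.tendsto 0).comp hl'
    rw [Real.sqrt_zero] at h1
    exact h1.congr fun t => Real.sqrt_sq (norm_nonneg _)
  have hy : Tendsto (fun t => y t i - z t) atTop (𝓝 0) := by
    refine squeeze_zero_norm' ?_ hE0
    filter_upwards [eventually_ge_atTop 0] with t ht using hyz t ht i
  have h := hy.add (tendsto_iff_norm_sub_tendsto_zero.2 hz0)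
  rw [zero_add] at h
  exact h.congr fun t => by abel

/-- The tracking bound is a Carathéodory solution of a scalar differential equation. -/
theorem tracking_bound_solution {F : Type*} [NormedAddCommGroup F] {u : ℝ → F}
    (hu : LocallyIntegrableOn u (Ici 0)) {c lam r : ℝ} (hlam : 0 < lam) :
    IsCaratheodorySolution (fun t e => -(-Real.log lam * e) + c * ‖u t‖) 0
      (fun t => c * (lam ^ t * r + ∫ τ in (0 : ℝ)..t, lam ^ (t - τ) * ‖u τ‖)) := by
  -- Splitting `λ^(t-τ)` removes `t` from the integrand, so the product rule applies to an
  -- exponential times a primitive.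
  set v : ℝ → ℝ := fun τ => Real.exp (-Real.log lam * τ) * ‖u τ‖ with hv
  have hvi : LocallyIntegrableOn v (Ici 0) := by
    exact hu.norm.continuousOn_mul (by fun_prop) isClosed_Ici.isLocallyClosed
  have heq : (fun t => c * (lam ^ t * r + ∫ τ in (0 : ℝ)..t, lam ^ (t - τ) * ‖u τ‖))
      = fun t => Real.exp (Real.log lam * t) * (c * r + c * ∫ τ in (0 : ℝ)..t, v τ) := by
    funext t
    have h1 : ∀ τ, lam ^ (t - τ) * ‖u τ‖ = Real.exp (Real.log lam * t) * v τ := fun τ => by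
      rw [hv, Real.rpow_def_of_pos hlam, ← mul_assoc, ← Real.exp_add]
      congr 2
      ring
    rw [intervalIntegral.integral_congr fun τ _ => h1 τ, intervalIntegral.integral_const_mul,
      Real.rpow_def_of_pos hlam]
    ring
  rw [heq]
  refine ⟨fun T hT => (absolutelyContinuous_exp _ 0 T).fun_mul
    ((absolutelyContinuous_const _ _ _).fun_add
      ((absolutelyContinuous_primitive hvi hT).const_mul c)), ?_⟩
  filter_upwards [ae_hasDerivAt_primitive hvi] with t ht h0
  have h1 := (((hasDerivAt_id t).const_mul (Real.log lam)).exp).mul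
    (((ht h0).const_mul c).const_add (c * r))
  convert! h1 using 1
  have h2 : Real.exp (Real.log lam * t) * v t = ‖u t‖ := by
    rw [hv, ← mul_assoc, ← Real.exp_add]
    simp
  simp only [id, mul_one]
  rw [← h2]
  ring

/-- The observation error itself need not obey a differential inequality, but its bound solves an
exact linear equation; that bound therefore serves as the Lyapunov variable `E`. -/
theorem InputOutputDynamics.IsFlowTracker.tendsto_optimal {N : ℕ} {S : InputOutputDynamics n d N}
    {Q : Set (AgentVec n d × (Fin N → ℝ))} (hS : S.IsFlowTracker Q) (hn : 0 < n)
    {f : Fin n → EuclideanSpace ℝ (Fin d) → ℝ} (hf : OptimizationAssumption f) {α : ℝ → ℝ}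
    (hα : StepSizeAssumption α) {u x : ℝ → AgentVec n d} {w : ℝ → Fin N → ℝ}
    (h : S.IsTrajectory u x w) (hQ : (x 0, w 0) ∈ Q)
    (hu : IsGradientFeedback f α u (fun t => S.out t (x t) (w t))) :
    ∃ xs ∈ optimalSet f, ∀ i, Tendsto (fun t => S.out t (x t) (w t) i) atTop (𝓝 xs) := by
  obtain ⟨c, lam, hc, h0, h1, htr⟩ := hS
  obtain ⟨hav, hb⟩ := htr u x w h hQ
  exact averaged_dynamics_converges hn hf hα hc.le (neg_pos.2 (Real.log_neg h0 h1)) hav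
    (tracking_bound_solution h.1 h0) hb hu

end

end PushSum

theorem mainTheorem2 (n d : ℕ) (hn : 0 < n)
    (L : ℝ → Matrix (Fin n) (Fin n) ℝ) (hL : PushSum.IsLaplacianProcess L)
    (Φ : ℝ → ℝ → Matrix (Fin n) (Fin n) ℝ) (hΦ : PushSum.IsFlow L Φ)
    (hP : PushSum.IsClassPStar Φ) (hErg : PushSum.IsWeaklyExponentiallyErgodic Φ) :
    -- the outputs are well defined along every trajectory starting in `Q`
    (∀ (u x : ℝ → PushSum.AgentVec n d) (w : ℝ → Fin n → ℝ),
      (PushSum.pushSum d L).IsTrajectory u x w → (x 0, w 0) ∈ PushSum.pushSumInit n d →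
        ∀ t, 0 ≤ t → ∀ i, 0 < w t i) ∧
    -- push-sum is a flow tracker
    (PushSum.pushSum d L).IsFlowTracker (PushSum.pushSumInit n d) ∧
    -- with the gradient feedback, all outputs converge to a common optimal point
    (∀ (f : Fin n → EuclideanSpace ℝ (Fin d) → ℝ), PushSum.OptimizationAssumption f →
      ∀ (α : ℝ → ℝ), PushSum.StepSizeAssumption α →
      ∀ (u x : ℝ → PushSum.AgentVec n d) (w : ℝ → Fin n → ℝ),
        (PushSum.pushSum d L).IsTrajectory u x w → (x 0, w 0) ∈ PushSum.pushSumInit n d →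
        PushSum.IsGradientFeedback f α u (fun t => (PushSum.pushSum d L).out t (x t) (w t)) →
        ∃ xstar ∈ PushSum.optimalSet f, ∀ i,
          Tendsto (fun t => (PushSum.pushSum d L).out t (x t) (w t) i) atTop (𝓝 xstar)) := by
  have htracker := PushSum.pushSum_isFlowTracker (d := d) hn hL hΦ hP hErg
  exact ⟨fun u x w h hQ => PushSum.pushSum_weight_pos hL hΦ hP h hQ, htracker,
    fun f hf α hα u x w h hQ hu => htracker.tendsto_optimal hn hf hα h hQ hu⟩
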